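/- Let $\mathbb K$ be the line $\mathbb R$ or the circle $\mathbb T=\mathbb R/2\pi\mathbb Z$; let $\mathcal S(\mathbb R)$ be the Schwartz space and $\mathcal S(\mathbb T)=C^\infty(\mathbb T)$. For $\kappa>0$ and $q\in\mathcal S(\mathbb K)$ (complex valued) put $$\alpha(\kappa;q)=\mathrm{Re}\sum_{l\ge 1}\frac{(-1)^l\,i^{\,l+1}\kappa^l}{l}\,\mathrm{tr}\Big(\big((\partial-\kappa)^{-1}q\,(\partial+\kappa)^{-1}\bar q\big)^l\Big),$$ where $q,\bar q$ act as multiplication operators and $(\partial\mp\kappa)^{-1}$ as Fourier multipliers on $L^2(\mathbb K)$. (i) Line. There is an absolute constant $c>0$ such that for every global solution $q\in C^\infty(\mathbb R;\mathcal S(\mathbb R))$ of $$i\partial_t q+\partial_{xx}q+i\partial_x(|q|^2q)=0$$ with $\|q(0)\|_{L^2}\le c$, every $\kappa>0$ and every $t\in\mathbb R$: all the operators $\big((\partial-\kappa)^{-1}q(t)(\partial+\kappa)^{-1}\overline{q(t)}\big)^l$, $l\ge1$, are trace class, the series defining $\alpha(\kappa;q(t))$ converges absolutely, and $\frac{d}{dt}\alpha(\kappa;q(t))=0$.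 (ii) Circle. For every $\kappa_0>0$ there is $c=c(\kappa_0)>0$ such that the same conclusion holds for every global solution $q\in C^\infty(\mathbb R;\mathcal S(\mathbb T))$ of the same equation on $\mathbb T$ with $\|q(0)\|_{L^2}\le c$, every $\kappa\ge\kappa_0$ and every $t\in\mathbb R$. -/

import Mathlib

open MeasureTheory Filter Topology
open scoped Real ENNReal SchwartzMap ContDiff BoundedContinuousFunction lp

noncomputable section

namespace DNLS

/-! ### Trace-class operators and the trace -/

section Trace

variable {H : Type*} [NormedAddCommGroup H] [InnerProductSpace ℂ H]

/-- Hilbert-Schmidt operators: `∑ ‖A eᵢ‖² < ∞` for an orthonormal (Hilbert) basis `(eᵢ)`.  The value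
of the sum does not depend on the basis. -/
def IsHilbertSchmidt (A : H →L[ℂ] H) : Prop :=
  ∃ (s : Set H) (b : HilbertBasis s ℂ H), Summable fun i => ‖A (b i)‖ ^ 2

/-- Trace-class operators: the products of two Hilbert-Schmidt operators. -/
def IsTraceClass (T : H →L[ℂ] H) : Prop :=
  ∃ A B : H →L[ℂ] H, IsHilbertSchmidt A ∧ IsHilbertSchmidt B ∧ T = A ∘L B

/-- The trace `∑ ⟨eᵢ, T eᵢ⟩` with respect to a Hilbert basis of `H`.  For trace-class `T` the sum
converges absolutely and does not depend on the basis. -/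
def trace [CompleteSpace H] (T : H →L[ℂ] H) : ℂ :=
  let b := (exists_hilbertBasis ℂ H).choose_spec.choose
  ∑' i, inner ℂ (b i) (T (b i))

end Trace

/-! ### Multiplication operators on `L²` -/

/-- The operator `f ↦ m f` on `L²(μ)`, for a bounded continuous function `m`. -/
def mulOp {X : Type*} [TopologicalSpace X] [MeasurableSpace X] [BorelSpace X] (μ : Measure X)
    (m : X →ᵇ ℂ) : Lp ℂ 2 μ →L[ℂ] Lp ℂ 2 μ :=
  (ContinuousLinearMap.mul ℂ ℂ).holderL μ ∞ 2 2
    (memLp_top_of_bound m.continuous.aestronglyMeasurable ‖m‖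
      (Eventually.of_forall m.norm_coe_le_norm)).toLp

/-! ### The operators `(∂ + a)⁻¹`, for real `a ≠ 0`, as Fourier multipliers -/

theorem norm_symbol_le (a y : ℝ) (ha : a ≠ 0) :
    ‖((a : ℂ) + (y : ℂ) * Complex.I)⁻¹‖ ≤ |a|⁻¹ := by
  rw [norm_inv]
  apply inv_anti₀ (abs_pos.mpr ha)
  simpa using Complex.abs_re_le_norm ((a : ℂ) + (y : ℂ) * Complex.I)

theorem symbol_ne_zero (a y : ℝ) (ha : a ≠ 0) : (a : ℂ) + (y : ℂ) * Complex.I ≠ 0 := by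
  intro h
  apply ha
  simpa using congrArg Complex.re h

/-- The symbol `1 / (a + 2πiξ)` of `(∂ + a)⁻¹` on the line, for the Fourier transform
`∫ f(x) e^{-2πixξ} dx`. -/
def lineSymbol (a : ℝ) (ha : a ≠ 0) : ℝ →ᵇ ℂ :=
  BoundedContinuousFunction.ofNormedAddCommGroup
    (fun ξ : ℝ => ((a : ℂ) + ((2 * π * ξ : ℝ) : ℂ) * Complex.I)⁻¹)
    (Continuous.inv₀ (by fun_prop) fun ξ => symbol_ne_zero a (2 * π * ξ) ha)
    |a|⁻¹ fun ξ => norm_symbol_le a (2 * π * ξ) ha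

/-- `(∂ + a)⁻¹` on `L²(ℝ)`. -/
def lineResolvent (a : ℝ) (ha : a ≠ 0) :
    Lp ℂ 2 (volume : Measure ℝ) →L[ℂ] Lp ℂ 2 (volume : Measure ℝ) :=
  ((Lp.fourierTransformₗᵢ ℝ ℂ).symm : Lp ℂ 2 (volume : Measure ℝ) →L[ℂ] _) ∘L
    mulOp volume (lineSymbol a ha) ∘L
      ((Lp.fourierTransformₗᵢ ℝ ℂ) : Lp ℂ 2 (volume : Measure ℝ) →L[ℂ] _)

instance fact_two_pi_pos : Fact (0 < 2 * π) := ⟨Real.two_pi_pos⟩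

/-- The circle `ℝ / 2πℤ`. -/
abbrev Torus : Type := AddCircle (2 * π)

/-- `L²` of the circle.  The measure is normalized to total mass one; the operators and traces below
do not depend on the normalization. -/
abbrev L2Torus : Type := Lp ℂ 2 (AddCircle.haarAddCircle : Measure Torus)

theorem norm_symbol_mul_le (a : ℝ) (ha : a ≠ 0) (f : ℓ²(ℤ, ℂ)) (n : ℤ) :
    ‖((a : ℂ) + ((n : ℝ) : ℂ) * Complex.I)⁻¹ * f n‖ ≤ ‖((|a|⁻¹ : ℝ) • f) n‖ := by
  rw [norm_mul, lp.coeFn_smul, Pi.smul_apply, norm_smul, Real.norm_of_nonneg (by positivity)]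
  exact mul_le_mul_of_nonneg_right (norm_symbol_le a n ha) (norm_nonneg _)

/-- Multiplication by the symbol `n ↦ 1 / (a + i n)` on `ℓ²(ℤ)`, as a map. -/
def diagFun (a : ℝ) (ha : a ≠ 0) (f : ℓ²(ℤ, ℂ)) : ℓ²(ℤ, ℂ) :=
  ⟨fun n : ℤ => ((a : ℂ) + ((n : ℝ) : ℂ) * Complex.I)⁻¹ * f n,
    Memℓp.mono' (lp.memℓp ((|a|⁻¹ : ℝ) • f)) (norm_symbol_mul_le a ha f)⟩

theorem norm_diagFun_le (a : ℝ) (ha : a ≠ 0) (f : ℓ²(ℤ, ℂ)) :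
    ‖diagFun a ha f‖ ≤ |a|⁻¹ * ‖f‖ := by
  have h : ‖diagFun a ha f‖ ≤ ‖(|a|⁻¹ : ℝ) • f‖ :=
    lp.norm_mono (by simp) (norm_symbol_mul_le a ha f)
  rwa [norm_smul, Real.norm_of_nonneg (by positivity)] at h

/-- Multiplication by the symbol `n ↦ 1 / (a + i n)` on `ℓ²(ℤ)`, as a bounded operator. -/
def diagOp (a : ℝ) (ha : a ≠ 0) : ℓ²(ℤ, ℂ) →L[ℂ] ℓ²(ℤ, ℂ) :=
  LinearMap.mkContinuous
    { toFun := diagFun a ha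
      map_add' := fun f g => by ext n; exact mul_add _ _ _
      map_smul' := fun c f => by ext n; exact mul_left_comm _ _ _ }
    |a|⁻¹ (norm_diagFun_le a ha)

/-- `(∂ + a)⁻¹` on `L²` of the circle: it multiplies the `n`-th Fourier coefficient by
`1 / (a + i n)`. -/
def torusResolvent (a : ℝ) (ha : a ≠ 0) : L2Torus →L[ℂ] L2Torus :=
  ((fourierBasis (T := 2 * π)).repr.symm : ℓ²(ℤ, ℂ) →L[ℂ] L2Torus) ∘L
    diagOp a ha ∘L ((fourierBasis (T := 2 * π)).repr : L2Torus →L[ℂ] ℓ²(ℤ, ℂ))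

/-! ### The perturbation determinant -/

/-- `(∂ - κ)⁻¹ q (∂ + κ)⁻¹ q̄` on `L²(ℝ)`. -/
def lineOp (κ : ℝ) (hκ : 0 < κ) (q : 𝓢(ℝ, ℂ)) :
    Lp ℂ 2 (volume : Measure ℝ) →L[ℂ] Lp ℂ 2 (volume : Measure ℝ) :=
  lineResolvent (-κ) (neg_ne_zero.mpr hκ.ne') ∘L mulOp volume q.toBoundedContinuousFunction ∘L
    lineResolvent κ hκ.ne' ∘L mulOp volume (star q.toBoundedContinuousFunction)

/-- `(∂ - κ)⁻¹ q (∂ + κ)⁻¹ q̄` on `L²` of the circle. -/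
def torusOp (κ : ℝ) (hκ : 0 < κ) (q : C(Torus, ℂ)) : L2Torus →L[ℂ] L2Torus :=
  torusResolvent (-κ) (neg_ne_zero.mpr hκ.ne') ∘L
    mulOp AddCircle.haarAddCircle (BoundedContinuousFunction.mkOfCompact q) ∘L
      torusResolvent κ hκ.ne' ∘L
        mulOp AddCircle.haarAddCircle (star (BoundedContinuousFunction.mkOfCompact q))

section Alpha

variable {H : Type*} [NormedAddCommGroup H] [InnerProductSpace ℂ H] [CompleteSpace H]

/-- The `l`-th term `((-1)^l i^(l+1) κ^l / l) tr (T^l)`, for `l ≥ 1`. -/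
def detTerm (κ : ℝ) (T : H →L[ℂ] H) (l : ℕ) : ℂ :=
  (-1) ^ l * Complex.I ^ (l + 1) * (κ : ℂ) ^ l / (l : ℂ) * trace (T ^ l)

/-- `Re ∑_{l ≥ 1} ((-1)^l i^(l+1) κ^l / l) tr (T^l)`. -/
def alpha (κ : ℝ) (T : H →L[ℂ] H) : ℝ :=
  (∑' l : ℕ, detTerm κ T (l + 1)).re

end Alpha

/-! ### Smooth solutions -/

/-- `q ∈ C^∞(ℝ; 𝓢(ℝ))`: the curve `q` has derivatives of all orders in the topology of the Schwartz
space. -/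
def IsSmoothSchwartzCurve (q : ℝ → 𝓢(ℝ, ℂ)) : Prop :=
  ∃ Q : ℕ → ℝ → 𝓢(ℝ, ℂ), Q 0 = q ∧
    ∀ k t, Tendsto (fun h : ℝ => h⁻¹ • (Q k (t + h) - Q k t)) (𝓝[≠] 0) (𝓝 (Q (k + 1) t))

/-- `q ∈ C^∞(ℝ; C^∞(𝕋)) = C^∞(ℝ × 𝕋)`. -/
def IsSmoothTorusCurve (q : ℝ → C(Torus, ℂ)) : Prop :=
  ContDiff ℝ ∞ fun p : ℝ × ℝ => q p.1 (p.2 : Torus)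

/-- `i ∂ₜu + ∂ₓₓu + i ∂ₓ(|u|² u) = 0` at all `(t, x)`. -/
def SolvesDNLS (u : ℝ → ℝ → ℂ) : Prop :=
  ∀ t x : ℝ, Complex.I * deriv (fun s => u s x) t + iteratedDeriv 2 (u t) x
    + Complex.I * deriv (fun y => (‖u t y‖ : ℂ) ^ 2 * u t y) x = 0

end DNLS

end

/-! Write R a for (∂ + a)⁻¹, T = R(-κ) q R(κ) q̄ and f = |q|². Since (-1)^l i^(l+1) κ^l / l =
(i/l)(-iκ)^l, cyclicity of the trace turns dα/dt into Re i Σ_{l≥0} (-iκ)^(l+1) tr(T^l T'). The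
equation splits T' = U + V: U carries the terms i q'' and -i q̄'', V the terms -(f q)' and -(f q̄)'.

The relation R a f' R b = f R b - R a f + (b - a) R a f R b (`der_comm`) integrates by parts inside
the trace. With D(N) = tr(N R(-κ) f q R(κ) q̄) - tr(N T f) the outcome is tr(T^(l+1) U) = 2i D(T^l),
tr U = 0 and tr(T^l V) = -2κ D(T^l) (`trace_T_mul_U`, `trace_U`, `trace_T_mul_V`, `trace_V`). Hence
the dispersive contribution at power l + 1 cancels the nonlinear one at power l: the series
telescopes (`trace_pow_mul_eq_flux`), with a geometrically small remainder.

Convergence rests on T being a product of two Hilbert-Schmidt operators whose norms are bounded by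
‖q‖ in L². That norm is conserved (`norm_u_eq`), so smallness at time 0 gives κ‖T‖ ≤ 1/2 at all
times, and the series may be differentiated term by term (`hasDerivAt_alpha`).

The delicate terms are those without a power of T, where the pieces produced by integration by parts
need not be trace class one by one. They are controlled by tr [fg, R a] = 0 (`trace_commutator`): by
the resolvent identity this trace does not depend on a, and it tends to 0 as a → ∞.

The line and the circle enter only through the axioms of `ResolventCalculus`. The bound for κ‖T‖ is
‖q‖²/2 on the line, whatever κ is, and (κ⁻¹ + 4)‖q‖² on the circle, which is why κ₀ appears there.
-/

noncomputable section

namespace DNLS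

/-! ### Hilbert-Schmidt operators -/

section HilbertSchmidt

variable (H : Type*) [NormedAddCommGroup H] [InnerProductSpace ℂ H] [CompleteSpace H]

/-- The index set of the Hilbert basis used by `trace`. -/
def basisSet : Set H := (exists_hilbertBasis ℂ H).choose

/-- The Hilbert basis used by `trace`. -/
def stdBasis : HilbertBasis (basisSet H) ℂ H := (exists_hilbertBasis ℂ H).choose_spec.choose

/-- The Hilbert-Schmidt operators. -/
def HS : Submodule ℂ (H →L[ℂ] H) where
  carrier := {A | Memℓp (fun i => A (stdBasis H i)) 2}
  add_mem' := fun hA hB => hA.add hB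
  zero_mem' := zero_memℓp
  smul_mem' := fun c _ hA => hA.const_smul c

/-- The images of the basis vectors under a Hilbert-Schmidt operator. -/
def hsSeq : HS H →ₗ[ℂ] lp (fun _ : basisSet H => H) 2 where
  toFun A := ⟨fun i => A.1 (stdBasis H i), A.2⟩
  map_add' _ _ := rfl
  map_smul' _ _ := rfl

theorem clm_ext_stdBasis {H : Type*} [NormedAddCommGroup H] [InnerProductSpace ℂ H]
    [CompleteSpace H] {A B : H →L[ℂ] H} (h : ∀ i, A (stdBasis H i) = B (stdBasis H i)) : A = B := by
  refine ContinuousLinearMap.ext_on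
    (Submodule.dense_iff_topologicalClosure_eq_top.mpr (stdBasis H).dense_span) ?_
  rintro _ ⟨i, rfl⟩
  exact h i

theorem hsSeq_injective : Function.Injective (hsSeq H) := by
  intro A B h
  apply Subtype.ext
  apply clm_ext_stdBasis
  intro i
  exact congrFun (congrArg Subtype.val h) i

variable {H}

/-- The Hilbert-Schmidt norm. -/
def hsNorm (A : H →L[ℂ] H) : ℝ := √(∑' i, ‖A (stdBasis H i)‖ ^ 2)

theorem hsNorm_nonneg (A : H →L[ℂ] H) : 0 ≤ hsNorm A := Real.sqrt_nonneg _

theorem mem_HS_iff {A : H →L[ℂ] H} :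
    A ∈ HS H ↔ Summable fun i => ‖A (stdBasis H i)‖ ^ 2 := by
  change Memℓp _ 2 ↔ _
  rw [memℓp_gen_iff (by norm_num)]
  simp

theorem norm_hsSeq (A : HS H) : ‖hsSeq H A‖ = hsNorm A.1 := by
  rw [lp.norm_eq_tsum_rpow (by norm_num), hsNorm, Real.sqrt_eq_rpow]
  simp only [ENNReal.toReal_ofNat, Real.rpow_ofNat]
  rfl

theorem hsNorm_sq (A : H →L[ℂ] H) : hsNorm A ^ 2 = ∑' i, ‖A (stdBasis H i)‖ ^ 2 :=
  Real.sq_sqrt (tsum_nonneg fun _ => by positivity)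

/-- The basis underlying `trace` serves as the witness, so independence of the basis is never
needed. -/
theorem isHilbertSchmidt_of_mem {A : H →L[ℂ] H} (hA : A ∈ HS H) : IsHilbertSchmidt A :=
  ⟨_, stdBasis H, mem_HS_iff.mp hA⟩

theorem mem_HS_of_sum_le {A : H →L[ℂ] H} {C : ℝ} (hC : 0 ≤ C)
    (h : ∀ s : Finset (basisSet H), ∑ i ∈ s, ‖A (stdBasis H i)‖ ^ 2 ≤ C ^ 2) :
    A ∈ HS H ∧ hsNorm A ≤ C := by
  have hs := summable_of_sum_le (fun i => by positivity) h
  refine ⟨mem_HS_iff.mpr hs, ?_⟩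
  rw [hsNorm]
  exact Real.sqrt_le_iff.mpr ⟨hC, hs.tsum_le_of_sum_le h⟩

theorem hasSum_norm_sq_inner (x : H) :
    HasSum (fun i => ‖inner ℂ (stdBasis H i) x‖ ^ 2) (‖x‖ ^ 2) := by
  have h := (stdBasis H).hasSum_inner_mul_inner x x
  have h2 := Complex.hasSum_re h
  convert! h2 using 1
  · ext i
    rw [← inner_conj_symm x, ← Complex.normSq_eq_conj_mul_self, Complex.ofReal_re,
      Complex.normSq_eq_norm_sq]
  · rw [inner_self_eq_norm_sq_to_K]
    norm_cast

/-- By Parseval both sides are the sum of the squared matrix entries, in two orders. In [0, ∞] the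
exchange needs no summability, so it settles membership and norm of the adjoint together. -/
theorem tsum_enorm_sq_adjoint (A : H →L[ℂ] H) :
    ∑' i, ENNReal.ofReal (‖A (stdBasis H i)‖ ^ 2) =
      ∑' i, ENNReal.ofReal (‖A.adjoint (stdBasis H i)‖ ^ 2) := by
  have key : ∀ B : H →L[ℂ] H, ∀ i, ENNReal.ofReal (‖B (stdBasis H i)‖ ^ 2) =
      ∑' j, ENNReal.ofReal (‖inner ℂ (stdBasis H j) (B (stdBasis H i))‖ ^ 2) := by
    intro B i
    rw [← (hasSum_norm_sq_inner _).tsum_eq, ENNReal.ofReal_tsum_of_nonneg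
      (fun _ => by positivity) (hasSum_norm_sq_inner _).summable]
  simp_rw [key]
  rw [ENNReal.tsum_comm]
  refine tsum_congr fun i => tsum_congr fun j => ?_
  rw [ContinuousLinearMap.adjoint_inner_right, norm_inner_symm]

theorem mem_HS_iff_ennreal {A : H →L[ℂ] H} :
    A ∈ HS H ↔ ∑' i, ENNReal.ofReal (‖A (stdBasis H i)‖ ^ 2) ≠ ⊤ := by
  rw [mem_HS_iff]
  refine ⟨fun h => h.tsum_ofReal_ne_top, fun h => ?_⟩
  have := ENNReal.summable_toReal h
  simpa [ENNReal.toReal_ofReal, sq_nonneg] using this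

theorem hsNorm_eq_ennreal (A : H →L[ℂ] H) :
    hsNorm A = √(∑' i, ENNReal.ofReal (‖A (stdBasis H i)‖ ^ 2)).toReal := by
  rw [hsNorm, ENNReal.tsum_toReal_eq (fun _ => ENNReal.ofReal_ne_top)]
  simp

theorem adjoint_mem_HS {A : H →L[ℂ] H} (hA : A ∈ HS H) : A.adjoint ∈ HS H := by
  rwa [mem_HS_iff_ennreal, ← tsum_enorm_sq_adjoint, ← mem_HS_iff_ennreal]

theorem hsNorm_adjoint (A : H →L[ℂ] H) : hsNorm A.adjoint = hsNorm A := by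
  rw [hsNorm_eq_ennreal, hsNorm_eq_ennreal, ← tsum_enorm_sq_adjoint]

theorem mul_mem_HS (X : H →L[ℂ] H) {A : H →L[ℂ] H} (hA : A ∈ HS H) :
    X * A ∈ HS H ∧ hsNorm (X * A) ≤ ‖X‖ * hsNorm A := by
  refine mem_HS_of_sum_le (by positivity [hsNorm_nonneg A]) fun s => ?_
  calc ∑ i ∈ s, ‖(X * A) (stdBasis H i)‖ ^ 2
      ≤ ∑ i ∈ s, ‖X‖ ^ 2 * ‖A (stdBasis H i)‖ ^ 2 := by
        refine Finset.sum_le_sum fun i _ => ?_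
        rw [← mul_pow]
        exact pow_le_pow_left₀ (norm_nonneg _) (X.le_opNorm _) 2
    _ = ‖X‖ ^ 2 * ∑ i ∈ s, ‖A (stdBasis H i)‖ ^ 2 := by rw [Finset.mul_sum]
    _ ≤ ‖X‖ ^ 2 * hsNorm A ^ 2 := by
        rw [hsNorm_sq]
        gcongr
        exact (mem_HS_iff.mp hA).sum_le_tsum _ fun _ _ => by positivity
    _ = _ := by ring

theorem HS_mul_mem (X : H →L[ℂ] H) {A : H →L[ℂ] H} (hA : A ∈ HS H) :
    A * X ∈ HS H ∧ hsNorm (A * X) ≤ hsNorm A * ‖X‖ := by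
  have h := mul_mem_HS X.adjoint (adjoint_mem_HS hA)
  have h2 : X.adjoint * A.adjoint = (A * X).adjoint := (ContinuousLinearMap.adjoint_comp A X).symm
  rw [h2] at h
  refine ⟨by simpa using adjoint_mem_HS h.1, ?_⟩
  rw [hsNorm_adjoint, hsNorm_adjoint, LinearIsometryEquiv.norm_map, mul_comm] at h
  exact h.2

theorem norm_le_hsNorm {A : H →L[ℂ] H} (hA : A ∈ HS H) : ‖A‖ ≤ hsNorm A := by
  refine A.opNorm_le_bound (hsNorm_nonneg A) fun v => ?_
  refine le_of_sq_le_sq ?_ (by positivity [hsNorm_nonneg A])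
  -- Parseval for A v, followed by Cauchy-Schwarz in each coefficient ⟨A* eᵢ, v⟩.
  rw [mul_pow, ← hsNorm_adjoint, hsNorm_sq, ← (hasSum_norm_sq_inner (A v)).tsum_eq,
    ← tsum_mul_right]
  refine (hasSum_norm_sq_inner (A v)).summable.tsum_le_tsum (fun i => ?_)
    ((mem_HS_iff.mp (adjoint_mem_HS hA)).mul_right _)
  rw [← mul_pow, ← ContinuousLinearMap.adjoint_inner_left]
  exact pow_le_pow_left₀ (norm_nonneg _) (norm_inner_le_norm _ _) 2

/-! ### The trace -/

theorem trace_eq (K : H →L[ℂ] H) :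
    trace K = ∑' i, inner ℂ (stdBasis H i) (K (stdBasis H i)) := rfl

theorem hasSum_trace_mul {A B : H →L[ℂ] H} (hA : A ∈ HS H) (hB : B ∈ HS H) :
    HasSum (fun i => inner ℂ (stdBasis H i) ((A * B) (stdBasis H i)))
      (inner ℂ (hsSeq H ⟨_, adjoint_mem_HS hA⟩) (hsSeq H ⟨B, hB⟩)) := by
  convert! lp.hasSum_inner (𝕜 := ℂ) (hsSeq H ⟨_, adjoint_mem_HS hA⟩) (hsSeq H ⟨B, hB⟩) using 2 with i
  exact (ContinuousLinearMap.adjoint_inner_left A _ _).symm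

theorem trace_mul_eq {A B : H →L[ℂ] H} (hA : A ∈ HS H) (hB : B ∈ HS H) :
    trace (A * B) = inner ℂ (hsSeq H ⟨_, adjoint_mem_HS hA⟩) (hsSeq H ⟨B, hB⟩) :=
  (hasSum_trace_mul hA hB).tsum_eq

theorem norm_trace_mul_le {A B : H →L[ℂ] H} (hA : A ∈ HS H) (hB : B ∈ HS H) :
    ‖trace (A * B)‖ ≤ hsNorm A * hsNorm B := by
  rw [trace_mul_eq hA hB]
  refine (norm_inner_le_norm _ _).trans_eq ?_
  rw [norm_hsSeq, norm_hsSeq, hsNorm_adjoint]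

theorem norm_hsSeq_adjoint (A : HS H) :
    ‖hsSeq H ⟨_, adjoint_mem_HS A.2⟩‖ = ‖hsSeq H A‖ := by
  rw [norm_hsSeq, norm_hsSeq, hsNorm_adjoint]

/-- The traces are ⟨A*, B⟩ and ⟨B*, A⟩ for the Hilbert-Schmidt inner product. Polarization reduces
their equality to norms, and the adjoint is a conjugate-linear isometry for the Hilbert-Schmidt
norm. -/
theorem trace_mul_comm {A B : H →L[ℂ] H} (hA : A ∈ HS H) (hB : B ∈ HS H) :
    trace (A * B) = trace (B * A) := by
  rw [trace_mul_eq hA hB, trace_mul_eq hB hA]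
  set A' : HS H := ⟨A, hA⟩
  set B' : HS H := ⟨B, hB⟩
  set As : HS H := ⟨_, adjoint_mem_HS hA⟩
  set Bs : HS H := ⟨_, adjoint_mem_HS hB⟩
  have e1 : ‖hsSeq H As + hsSeq H B'‖ = ‖hsSeq H Bs + hsSeq H A'‖ := by
    rw [← map_add, ← map_add, ← norm_hsSeq_adjoint]
    congr 2
    apply Subtype.ext
    simp [As, Bs, A', B', add_comm]
  have e2 : ‖hsSeq H As - hsSeq H B'‖ = ‖hsSeq H Bs - hsSeq H A'‖ := by
    rw [← map_sub, ← map_sub, ← norm_hsSeq_adjoint, ← norm_neg, ← map_neg]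
    congr 2
    apply Subtype.ext
    simp [As, Bs, A', B']
  -- Used for c = ±i: then (A* - cB)* = A + cB* = c(B* - cA), and |c| = 1.
  have e3 : ∀ c : ℂ, c * starRingEnd ℂ c = 1 → starRingEnd ℂ c = -c →
      ‖hsSeq H As - c • hsSeq H B'‖ = ‖hsSeq H Bs - c • hsSeq H A'‖ := by
    intro c hc hc'
    have hn : ‖c‖ = 1 := by
      rw [Complex.mul_conj, Complex.normSq_eq_norm_sq] at hc
      have : ‖c‖ ^ 2 = 1 := by exact_mod_cast hc
      exact (pow_eq_one_iff_of_nonneg (norm_nonneg c) two_ne_zero).mp this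
    rw [← map_smul, ← map_smul, ← map_sub, ← map_sub, ← norm_hsSeq_adjoint]
    rw [← one_mul ‖hsSeq H (Bs - c • A')‖, ← hn, ← norm_smul, ← map_smul]
    congr 2
    apply Subtype.ext
    have : c * c = -1 := by rw [hc'] at hc; linear_combination -hc
    simp only [As, Bs, A', B', Submodule.coe_smul, AddSubgroupClass.coe_sub, map_sub,
      map_smulₛₗ, ContinuousLinearMap.adjoint_adjoint, smul_sub, smul_smul, this, hc']
    module
  have e4 := e3 Complex.I (by simp) (by simp)
  have e5 := e3 (-Complex.I) (by simp) (by simp)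
  simp only [neg_smul, sub_neg_eq_add] at e5
  rw [inner_eq_sum_norm_sq_div_four, inner_eq_sum_norm_sq_div_four]
  simp only [RCLike.I_to_complex] at *
  rw [e1, e2, e4, e5]

variable (H) in
/-- The span of the products of two Hilbert-Schmidt operators. -/
def TC : Submodule ℂ (H →L[ℂ] H) :=
  Submodule.span ℂ {K | ∃ A B : H →L[ℂ] H, A ∈ HS H ∧ B ∈ HS H ∧ K = A * B}

theorem mul_mem_TC {A B : H →L[ℂ] H} (hA : A ∈ HS H) (hB : B ∈ HS H) : A * B ∈ TC H :=
  Submodule.subset_span ⟨A, B, hA, hB, rfl⟩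

theorem TC_mul_left (X : H →L[ℂ] H) {K : H →L[ℂ] H} (hK : K ∈ TC H) : X * K ∈ TC H := by
  induction hK using Submodule.span_induction with
  | mem K h =>
    obtain ⟨A, B, hA, hB, rfl⟩ := h
    rw [← mul_assoc]
    exact mul_mem_TC (mul_mem_HS X hA).1 hB
  | zero => simp
  | add K L _ _ hK hL => rw [mul_add]; exact add_mem hK hL
  | smul c K _ hK => rw [mul_smul_comm]; exact Submodule.smul_mem _ c hK

theorem TC_mul_right (X : H →L[ℂ] H) {K : H →L[ℂ] H} (hK : K ∈ TC H) : K * X ∈ TC H := by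
  induction hK using Submodule.span_induction with
  | mem K h =>
    obtain ⟨A, B, hA, hB, rfl⟩ := h
    rw [mul_assoc]
    exact mul_mem_TC hA (HS_mul_mem X hB).1
  | zero => simp
  | add K L _ _ hK hL => rw [add_mul]; exact add_mem hK hL
  | smul c K _ hK => rw [smul_mul_assoc]; exact Submodule.smul_mem _ c hK

/-- `trace` is a `tsum`, equal to 0 by convention when the series diverges; additivity therefore
needs this. -/
theorem summable_of_mem_TC {K : H →L[ℂ] H} (hK : K ∈ TC H) :
    Summable fun i => inner ℂ (stdBasis H i) (K (stdBasis H i)) := by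
  induction hK using Submodule.span_induction with
  | mem K h =>
    obtain ⟨A, B, hA, hB, rfl⟩ := h
    exact (hasSum_trace_mul hA hB).summable
  | zero => simp
  | add K L _ _ hK hL => simpa [inner_add_right] using hK.add hL
  | smul c K _ hK => simpa [inner_smul_right] using hK.mul_left c

theorem trace_add {K L : H →L[ℂ] H} (hK : K ∈ TC H) (hL : L ∈ TC H) :
    trace (K + L) = trace K + trace L := by
  simp only [trace_eq]
  rw [← (summable_of_mem_TC hK).tsum_add (summable_of_mem_TC hL)]
  simp

theorem trace_smul (c : ℂ) (K : H →L[ℂ] H) : trace (c • K) = c * trace K := by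
  simp only [trace_eq]
  rw [← tsum_mul_left]
  simp

theorem trace_neg (K : H →L[ℂ] H) : trace (-K) = -trace K := by
  simpa using trace_smul (-1) K

theorem trace_sub {K L : H →L[ℂ] H} (hK : K ∈ TC H) (hL : L ∈ TC H) :
    trace (K - L) = trace K - trace L := by
  rw [sub_eq_add_neg, trace_add hK (neg_mem hL), trace_neg, sub_eq_add_neg]

theorem trace_zero : trace (0 : H →L[ℂ] H) = 0 := by simp [trace_eq]

/-- For K = AB, both sides equal tr(B X A): X is absorbed first into A, then into B. -/
theorem trace_comm_TC (X : H →L[ℂ] H) {K : H →L[ℂ] H} (hK : K ∈ TC H) :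
    trace (X * K) = trace (K * X) := by
  induction hK using Submodule.span_induction with
  | mem K h =>
    obtain ⟨A, B, hA, hB, rfl⟩ := h
    rw [← mul_assoc, trace_mul_comm (mul_mem_HS X hA).1 hB, mul_assoc A,
      trace_mul_comm hA (HS_mul_mem X hB).1, mul_assoc]
  | zero => simp [trace_zero]
  | add K L hK' hL' hK hL =>
    rw [mul_add, add_mul, trace_add (TC_mul_left X hK') (TC_mul_left X hL'),
      trace_add (TC_mul_right X hK') (TC_mul_right X hL'), hK, hL]
  | smul c K _ hK => rw [mul_smul_comm, smul_mul_assoc, trace_smul, trace_smul, hK]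

end HilbertSchmidt

end DNLS

end

noncomputable section

namespace DNLS

/-! ### Multiplication operators -/

section MulOp

variable {X : Type*} [TopologicalSpace X] [MeasurableSpace X] [BorelSpace X] (μ : Measure X)

theorem coeFn_mulOp (m : X →ᵇ ℂ) (u : Lp ℂ 2 μ) : mulOp μ m u =ᵐ[μ] fun x => m x * u x := by
  have hm := memLp_top_of_bound (μ := μ) m.continuous.aestronglyMeasurable ‖m‖
    (Eventually.of_forall m.norm_coe_le_norm)
  have h := (ContinuousLinearMap.mul ℂ ℂ).coeFn_holder (r := 2) (hm.toLp) u
  filter_upwards [h, hm.coeFn_toLp] with x hx hx2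
  exact hx.trans (by rw [hx2]; rfl)

theorem mulOp_mul (f g : X →ᵇ ℂ) : mulOp μ (f * g) = mulOp μ f * mulOp μ g := by
  ext1 u
  apply Lp.ext
  filter_upwards [coeFn_mulOp μ (f * g) u, coeFn_mulOp μ f (mulOp μ g u), coeFn_mulOp μ g u]
    with x h1 h2 h3
  rw [mul_apply_eq_comp, h1, h2, h3, BoundedContinuousFunction.mul_apply, mul_assoc]

theorem mulOp_add (f g : X →ᵇ ℂ) : mulOp μ (f + g) = mulOp μ f + mulOp μ g := by
  ext1 u
  apply Lp.ext
  rw [_root_.add_apply]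
  filter_upwards [coeFn_mulOp μ (f + g) u, coeFn_mulOp μ f u, coeFn_mulOp μ g u,
    Lp.coeFn_add (mulOp μ f u) (mulOp μ g u)] with x h1 h2 h3 h4
  rw [h4, Pi.add_apply, h1, h2, h3, BoundedContinuousFunction.add_apply, add_mul]

theorem mulOp_smul (c : ℂ) (f : X →ᵇ ℂ) : mulOp μ (c • f) = c • mulOp μ f := by
  ext1 u
  apply Lp.ext
  rw [_root_.smul_apply]
  filter_upwards [coeFn_mulOp μ (c • f) u, coeFn_mulOp μ f u,
    Lp.coeFn_smul c (mulOp μ f u)] with x h1 h2 h4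
  rw [h4, Pi.smul_apply, h1, h2]
  simp [mul_assoc]

theorem mulOp_sub (f g : X →ᵇ ℂ) : mulOp μ (f - g) = mulOp μ f - mulOp μ g := by
  rw [eq_sub_iff_add_eq, ← mulOp_add, sub_add_cancel]

theorem mulOp_comm (f g : X →ᵇ ℂ) : mulOp μ f * mulOp μ g = mulOp μ g * mulOp μ f := by
  rw [← mulOp_mul, mul_comm, mulOp_mul]

theorem memLp_mul {f g : X →ᵇ ℂ} (hg : MemLp g 2 μ) : MemLp (f * g : X →ᵇ ℂ) 2 μ := by
  have := (memLp_top_of_bound (μ := μ) f.continuous.aestronglyMeasurable ‖f‖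
    (Eventually.of_forall f.norm_coe_le_norm))
  exact hg.mul (r := 2) this

omit [BorelSpace X] in
theorem memLp_star {f : X →ᵇ ℂ} (hf : MemLp f 2 μ) : MemLp (star f : X →ᵇ ℂ) 2 μ := by
  simpa using hf.star

end MulOp

/-! ### Resolvents of `∂` acting on `L²` -/

/-- The resolvents `R a = (∂ + a)⁻¹` of a derivation `∂` on `L²(μ)`: `Der f f'` says that `f' = ∂f`.
The function `w` is a weight by which the coefficients of the operators can be divided. -/
structure ResolventCalculus {X : Type*} [TopologicalSpace X] [MeasurableSpace X] [BorelSpace X]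
    (μ : Measure X) where
  R : ℝ → (Lp ℂ 2 μ →L[ℂ] Lp ℂ 2 μ)
  Der : (X →ᵇ ℂ) → (X →ᵇ ℂ) → Prop
  hsConst : ℝ → ℝ
  w : X →ᵇ ℂ
  w' : X →ᵇ ℂ
  der_mul : ∀ {f f' g g' : X →ᵇ ℂ}, Der f f' → Der g g' → Der (f * g) (f' * g + f * g')
  der_add : ∀ {f f' g g' : X →ᵇ ℂ}, Der f f' → Der g g' → Der (f + g) (f' + g')
  der_star : ∀ {f f' : X →ᵇ ℂ}, Der f f' → Der (star f) (star f')
  integral_der : ∀ {f f' : X →ᵇ ℂ}, Der f f' → Integrable f μ → Integrable f' μ → ∫ x, f' x ∂μ = 0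
  -- Formally f' = (∂ + a) f - f (∂ + b) + (b - a) f, multiplied by R a on the left and R b on the
  -- right.
  der_comm : ∀ {f f' : X →ᵇ ℂ}, Der f f' → ∀ {a b : ℝ}, a ≠ 0 → b ≠ 0 →
    R a * mulOp μ f' * R b =
      mulOp μ f * R b - R a * mulOp μ f + ((b - a : ℝ) : ℂ) • (R a * mulOp μ f * R b)
  resolvent : ∀ {a b : ℝ}, a ≠ 0 → b ≠ 0 → R b = R a + ((a - b : ℝ) : ℂ) • (R a * R b)
  norm_le : ∀ {a : ℝ}, a ≠ 0 → ‖R a‖ ≤ |a|⁻¹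
  hs : ∀ {a : ℝ}, a ≠ 0 → ∀ {f : X →ᵇ ℂ} (hf : MemLp f 2 μ),
    R a * mulOp μ f ∈ HS (Lp ℂ 2 μ) ∧ hsNorm (R a * mulOp μ f) ≤ hsConst a * ‖hf.toLp‖
  -- This decay is what makes the trace of a commutator vanish in the limit a → ∞.
  hsConst_tendsto : Tendsto hsConst atTop (𝓝 0)
  der_w : Der w w'
  memLp_w : MemLp w 2 μ
  memLp_w' : MemLp w' 2 μ

/-! ### Regular coefficients and their Hilbert-Schmidt products with resolvents -/

namespace ResolventCalculus

variable {X : Type*} [TopologicalSpace X] [MeasurableSpace X] [BorelSpace X] {μ : Measure X}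
  (C : ResolventCalculus μ)

/-- `f ∈ L²` has the derivative `f' ∈ L²`. -/
structure Reg (f f' : X →ᵇ ℂ) : Prop where
  der : C.Der f f'
  memLp : MemLp f 2 μ
  memLp' : MemLp f' 2 μ

/-- `f` is the product of the weight and a function in `L²`. -/
def Divisible (f : X →ᵇ ℂ) : Prop := ∃ g : X →ᵇ ℂ, MemLp g 2 μ ∧ f = g * C.w

variable {C}

theorem Reg.mul {f f' g g' : X →ᵇ ℂ} (hf : C.Reg f f') (hg : C.Reg g g') :
    C.Reg (f * g) (f' * g + f * g') where
  der := C.der_mul hf.der hg.der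
  memLp := memLp_mul μ hg.memLp
  memLp' := (memLp_mul μ hg.memLp).add (memLp_mul μ hg.memLp')

theorem Reg.add {f f' g g' : X →ᵇ ℂ} (hf : C.Reg f f') (hg : C.Reg g g') :
    C.Reg (f + g) (f' + g') where
  der := C.der_add hf.der hg.der
  memLp := hf.memLp.add hg.memLp
  memLp' := hf.memLp'.add hg.memLp'

theorem Reg.star {f f' : X →ᵇ ℂ} (hf : C.Reg f f') : C.Reg (star f) (star f') where
  der := C.der_star hf.der
  memLp := memLp_star μ hf.memLp
  memLp' := memLp_star μ hf.memLp'

theorem reg_w : C.Reg C.w C.w' := ⟨C.der_w, C.memLp_w, C.memLp_w'⟩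

theorem Divisible.mul {f : X →ᵇ ℂ} (hf : C.Divisible f) (g : X →ᵇ ℂ) : C.Divisible (f * g) := by
  obtain ⟨h, hh, rfl⟩ := hf
  exact ⟨g * h, memLp_mul μ hh, by ring⟩

variable (C)

local notation "M" => mulOp μ

theorem hs_left {a : ℝ} (ha : a ≠ 0) {f : X →ᵇ ℂ} (hf : MemLp f 2 μ) :
    C.R a * M f ∈ HS (Lp ℂ 2 μ) := (C.hs ha hf).1

variable {C}

theorem Reg.commutator {f f' : X →ᵇ ℂ} (hf : C.Reg f f') {a : ℝ} (ha : a ≠ 0) :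
    M f * C.R a = C.R a * M f + C.R a * M f' * C.R a := by
  rw [C.der_comm hf.der ha ha]
  simp

/-- The field `hs` puts the resolvent on the left only; the commutator moves it across at the price
of one derivative. -/
theorem Reg.hs_right {f f' : X →ᵇ ℂ} (hf : C.Reg f f') {a : ℝ} (ha : a ≠ 0) :
    M f * C.R a ∈ HS (Lp ℂ 2 μ) := by
  rw [hf.commutator ha]
  exact add_mem (C.hs_left ha hf.memLp) (HS_mul_mem _ (C.hs_left ha hf.memLp')).1

theorem hsNorm_add_le {H : Type*} [NormedAddCommGroup H] [InnerProductSpace ℂ H] [CompleteSpace H]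
    {A B : H →L[ℂ] H} (hA : A ∈ HS H) (hB : B ∈ HS H) : hsNorm (A + B) ≤ hsNorm A + hsNorm B := by
  have h := norm_add_le (hsSeq H ⟨A, hA⟩) (hsSeq H ⟨B, hB⟩)
  rwa [← map_add, norm_hsSeq, norm_hsSeq, norm_hsSeq] at h

theorem Reg.hsNorm_right_le {f f' : X →ᵇ ℂ} (hf : C.Reg f f') {a : ℝ} (ha : 1 ≤ a) :
    hsNorm (M f * C.R a) ≤ hsNorm (C.R a * M f) + hsNorm (C.R a * M f') := by
  have ha0 : a ≠ 0 := by positivity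
  rw [hf.commutator ha0]
  refine (hsNorm_add_le (C.hs_left ha0 hf.memLp) (HS_mul_mem _ (C.hs_left ha0 hf.memLp')).1).trans ?_
  gcongr
  refine (HS_mul_mem _ (C.hs_left ha0 hf.memLp')).2.trans ?_
  refine mul_le_of_le_one_right (hsNorm_nonneg _) ((C.norm_le ha0).trans ?_)
  rw [abs_of_pos (by positivity)]
  exact inv_le_one_of_one_le₀ ha

variable (C) in
theorem tendsto_hsNorm {f : X →ᵇ ℂ} (hf : MemLp f 2 μ) :
    Tendsto (fun a => hsNorm (C.R a * M f)) atTop (𝓝 0) := by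
  have h := C.hsConst_tendsto.mul_const ‖hf.toLp‖
  rw [zero_mul] at h
  refine squeeze_zero' (Eventually.of_forall fun a => hsNorm_nonneg _) ?_ h
  filter_upwards [eventually_gt_atTop 0] with a ha
  exact (C.hs ha.ne' hf).2

/-! ### Cyclicity of the trace when a single factor is not trace class -/

/-- The factorization g = k w puts k next to R b and w next to R a, so that R b k and w R a are both
Hilbert-Schmidt and every rotation is legitimate. -/
theorem trace_rotate {a b : ℝ} (ha : a ≠ 0) (hb : b ≠ 0) {f f' g : X →ᵇ ℂ} (hf : C.Reg f f')
    (hg : C.Divisible g) :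
    trace (C.R b * M g * (C.R a * M f)) = trace (M f * C.R b * (M g * C.R a)) := by
  obtain ⟨k, hk, rfl⟩ := hg
  have h1 := C.hs_left hb hk
  have h2 := C.reg_w.hs_right ha
  have h3 := hf.hs_right hb
  calc trace (C.R b * M (k * C.w) * (C.R a * M f))
      = trace ((C.R b * M k) * (M C.w * C.R a * M f)) := by simp only [mulOp_mul, mul_assoc]
    _ = trace ((M C.w * C.R a * (M f * C.R b)) * M k) := by
        rw [trace_mul_comm h1 (HS_mul_mem _ h2).1]
        simp only [mul_assoc]
    _ = trace ((M k * (M C.w * C.R a)) * (M f * C.R b)) := by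
        rw [← trace_comm_TC _ (mul_mem_TC h2 h3)]
        simp only [mul_assoc]
    _ = _ := by
        rw [trace_mul_comm (mul_mem_HS _ h2).1 h3, mulOp_mul, mul_assoc (M k)]

/-! ### Commutators of multiplications and resolvents have trace zero -/

theorem commutator_eq {f f' g g' : X →ᵇ ℂ} (hf : C.Reg f f') (hg : C.Reg g g') {a : ℝ}
    (ha : a ≠ 0) :
    M (f * g) * C.R a - C.R a * M (f * g) =
      C.R a * M f' * (M g * C.R a) + C.R a * M g' * (M f * C.R a) := by
  rw [(hf.mul hg).commutator ha, mulOp_add, mulOp_mul, mul_comm f g', mulOp_mul, mulOp_mul]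
  noncomm_ring

/-- In the product rule for (fg)' the underived factor sits beside the second resolvent, which makes
each term a product of two Hilbert-Schmidt operators. -/
theorem commutator_mem {f f' g g' : X →ᵇ ℂ} (hf : C.Reg f f') (hg : C.Reg g g') {a : ℝ}
    (ha : a ≠ 0) : M (f * g) * C.R a - C.R a * M (f * g) ∈ TC (Lp ℂ 2 μ) := by
  rw [commutator_eq hf hg ha]
  exact add_mem (mul_mem_TC (C.hs_left ha hf.memLp') (hg.hs_right ha))
    (mul_mem_TC (C.hs_left ha hg.memLp') (hf.hs_right ha))

/-- Two resolvents suffice for trace class: the weight w is commuted between them on one side, and g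
on the other. The bounded factors k, w and g are then rotated one at a time. -/
theorem trace_mul_resolvent_sq {f f' g g' g'' : X →ᵇ ℂ} (hf : C.Divisible f) (hf' : C.Reg f f')
    (hg : C.Reg g g') (hg' : C.Reg g' g'') {a b : ℝ} (ha : a ≠ 0) (hb : b ≠ 0) :
    M (f * g) * (C.R a * C.R b) ∈ TC (Lp ℂ 2 μ) ∧ C.R a * C.R b * M (f * g) ∈ TC (Lp ℂ 2 μ) ∧
    trace (M (f * g) * (C.R a * C.R b)) = trace (C.R a * C.R b * M (f * g)) := by
  obtain ⟨k, hk, rfl⟩ := hf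
  have hL : C.R a * C.R b * M (k * C.w) ∈ TC (Lp ℂ 2 μ) := by
    have : C.R a * C.R b * M (k * C.w) = C.R a * M C.w * (C.R b * M k) -
        C.R a * (C.R b * M C.w' * (C.R b * M k)) := by
      have h := C.reg_w.commutator hb
      rw [mul_comm k, mulOp_mul]
      have h2 : C.R b * M C.w = M C.w * C.R b - C.R b * M C.w' * C.R b := by rw [h]; abel
      calc C.R a * C.R b * (M C.w * M k) = C.R a * (C.R b * M C.w) * M k := by noncomm_ring
        _ = _ := by rw [h2]; noncomm_ring
    rw [this]
    exact sub_mem (mul_mem_TC (C.hs_left ha C.memLp_w) (C.hs_left hb hk))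
      (TC_mul_left _ (mul_mem_TC (C.hs_left hb C.memLp_w') (C.hs_left hb hk)))
  have hL' : M (C.w * g) * (C.R a * C.R b) ∈ TC (Lp ℂ 2 μ) := by
    have : M (C.w * g) * (C.R a * C.R b) = M C.w * C.R a * (M g * C.R b) +
        M C.w * C.R a * (M g' * C.R a) * C.R b := by
      rw [mulOp_mul]
      calc M C.w * M g * (C.R a * C.R b) = M C.w * (M g * C.R a) * C.R b := by noncomm_ring
        _ = _ := by rw [hg.commutator ha]; noncomm_ring
    rw [this]
    exact add_mem (mul_mem_TC (C.reg_w.hs_right ha) (hg.hs_right hb))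
      (TC_mul_right _ (mul_mem_TC (C.reg_w.hs_right ha) (hg'.hs_right ha)))
  have e1 : M (k * C.w * g) * (C.R a * C.R b) = M k * (M (C.w * g) * (C.R a * C.R b)) := by
    rw [mul_assoc k, mulOp_mul, mul_assoc]
  have e2 : C.R a * C.R b * M (k * C.w * g) = C.R a * C.R b * M (k * C.w) * M g := by
    rw [mulOp_mul μ (k * C.w), mul_assoc _ _ (M g)]
  refine ⟨?_, ?_, ?_⟩
  · rw [e1]; exact TC_mul_left _ hL'
  · rw [e2]; exact TC_mul_right _ hL
  · have h1 : M g * C.R a * (C.R b * M k) ∈ TC (Lp ℂ 2 μ) :=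
      mul_mem_TC (hg.hs_right ha) (C.hs_left hb hk)
    rw [e1, e2, ← trace_comm_TC _ hL, trace_comm_TC _ hL']
    calc trace (M (C.w * g) * (C.R a * C.R b) * M k)
        = trace (M C.w * (M g * C.R a * (C.R b * M k))) := by simp only [mulOp_mul, mul_assoc]
      _ = trace (M g * C.R a * (C.R b * M k) * M C.w) := trace_comm_TC _ h1
      _ = _ := by simp only [mulOp_mul, mul_assoc]

/-- By the resolvent identity the two commutators differ by (a - b)[fg, R a R b], whose trace is
zero. -/
theorem trace_commutator_const {f f' g g' g'' : X →ᵇ ℂ} (hf : C.Divisible f) (hf' : C.Reg f f')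
    (hg : C.Reg g g') (hg' : C.Reg g' g'') {a b : ℝ} (ha : a ≠ 0) (hb : b ≠ 0) :
    trace (M (f * g) * C.R b - C.R b * M (f * g)) =
      trace (M (f * g) * C.R a - C.R a * M (f * g)) := by
  obtain ⟨h1, h2, h3⟩ := trace_mul_resolvent_sq hf hf' hg hg' ha hb
  have e : M (f * g) * C.R b - C.R b * M (f * g) = (M (f * g) * C.R a - C.R a * M (f * g)) +
      ((a - b : ℝ) : ℂ) • (M (f * g) * (C.R a * C.R b) - C.R a * C.R b * M (f * g)) := by
    conv_lhs => rw [C.resolvent ha hb]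
    simp only [mul_add, add_mul, mul_smul_comm, smul_mul_assoc, smul_sub]
    abel
  rw [e, trace_add (commutator_mem hf' hg ha) (Submodule.smul_mem _ _ (sub_mem h1 h2)), trace_smul,
    trace_sub h1 h2, h3, sub_self, mul_zero, add_zero]

/-- The trace does not depend on a, and as the parameter grows it is squeezed to 0 by products of
Hilbert-Schmidt norms. -/
theorem trace_commutator {f f' g g' g'' : X →ᵇ ℂ} (hf : C.Divisible f) (hf' : C.Reg f f')
    (hg : C.Reg g g') (hg' : C.Reg g' g'') {a : ℝ} (ha : a ≠ 0) :
    trace (M (f * g) * C.R a - C.R a * M (f * g)) = 0 := by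
  have hlim : Tendsto (fun b => trace (M (f * g) * C.R b - C.R b * M (f * g))) atTop (𝓝 0) := by
    have h1 := C.tendsto_hsNorm hf'.memLp
    have h2 := C.tendsto_hsNorm hf'.memLp'
    have h3 := C.tendsto_hsNorm hg.memLp
    have h4 := C.tendsto_hsNorm hg.memLp'
    refine squeeze_zero_norm' ?_ (by simpa using (h2.mul (h3.add h4)).add (h4.mul (h1.add h2)))
    filter_upwards [eventually_ge_atTop 1] with b hb
    have hb0 : b ≠ 0 := by positivity
    rw [commutator_eq hf' hg hb0, trace_add
      (mul_mem_TC (C.hs_left hb0 hf'.memLp') (hg.hs_right hb0))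
      (mul_mem_TC (C.hs_left hb0 hg.memLp') (hf'.hs_right hb0))]
    refine (norm_add_le _ _).trans ?_
    refine add_le_add
      ((norm_trace_mul_le (C.hs_left hb0 hf'.memLp') (hg.hs_right hb0)).trans ?_)
      ((norm_trace_mul_le (C.hs_left hb0 hg.memLp') (hf'.hs_right hb0)).trans ?_)
    · exact mul_le_mul_of_nonneg_left (hg.hsNorm_right_le hb) (hsNorm_nonneg _)
    · exact mul_le_mul_of_nonneg_left (hf'.hsNorm_right_le hb) (hsNorm_nonneg _)
  have hconst : Tendsto (fun b => trace (M (f * g) * C.R b - C.R b * M (f * g))) atTop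
      (𝓝 (trace (M (f * g) * C.R a - C.R a * M (f * g)))) := by
    refine tendsto_const_nhds.congr' ?_
    filter_upwards [eventually_gt_atTop 0] with b hb
    exact (trace_commutator_const hf hf' hg hg' ha hb.ne').symm
  exact tendsto_nhds_unique hconst hlim

/-- Formally this is tr [∂, R a f R b g] = 0, since ∂ commutes with the resolvents. -/
theorem trace_integrate_by_parts {f f' g g' g'' : X →ᵇ ℂ} (hf : C.Divisible f) (hf' : C.Reg f f')
    (hg : C.Reg g g') (hg' : C.Reg g' g'') {a b : ℝ} (ha : a ≠ 0) (hb : b ≠ 0) :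
    trace (C.R a * M f' * (C.R b * M g)) + trace (C.R a * M f * (C.R b * M g')) = 0 := by
  have hrot := trace_rotate hb ha hg hf
  have m1 := mul_mem_TC (C.hs_left ha hf'.memLp') (C.hs_left hb hg.memLp)
  have m2 := mul_mem_TC (hf'.hs_right hb) (hg'.hs_right ha)
  have m3 := mul_mem_TC (C.hs_left ha hf'.memLp) (C.hs_left hb hg.memLp)
  have m4 := mul_mem_TC (hf'.hs_right hb) (hg.hs_right ha)
  rw [trace_rotate hb ha hg' hf, trace_mul_comm (hg'.hs_right ha) (hf'.hs_right hb),
    ← trace_add m1 m2]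
  -- After rotating the second term the boundary terms f R b g cancel. What remains is the
  -- commutator [fg, R a] and a difference of two rotations of one product.
  have e : C.R a * M f' * (C.R b * M g) + M f * C.R b * (M g' * C.R a) =
      (M (f * g) * C.R a - C.R a * M (f * g)) + ((b - a : ℝ) : ℂ) •
        (C.R a * M f * (C.R b * M g) - M f * C.R b * (M g * C.R a)) := by
    have h1 := C.der_comm hf'.der ha hb
    have h2 := C.der_comm hg.der hb ha
    calc _ = (C.R a * M f' * C.R b) * M g + M f * (C.R b * M g' * C.R a) := by noncomm_ring
      _ = _ := by
        rw [h1, h2, mulOp_mul]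
        simp only [mul_add, add_mul, mul_sub, sub_mul, mul_smul_comm, smul_mul_assoc, smul_sub,
          mul_assoc]
        push_cast
        module
  rw [e, trace_add (commutator_mem hf' hg ha) (Submodule.smul_mem _ _ (sub_mem m3 m4)),
    trace_commutator hf hf' hg hg' ha, trace_smul, trace_sub m3 m4, hrot,
    trace_mul_comm (hg.hs_right ha) (hf'.hs_right hb)]
  simp

end ResolventCalculus

end DNLS

end

/-! ### The algebraic core: traces of powers of T against its time derivative -/

noncomputable section

namespace DNLS

namespace ResolventCalculus

variable {X : Type*} [TopologicalSpace X] [MeasurableSpace X] [BorelSpace X] {μ : Measure X}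

local notation "M" => mulOp μ

/-- Two coefficients `q` and `p` with their first two derivatives. -/
structure Jet (C : ResolventCalculus μ) where
  (q q₁ q₂ p p₁ p₂ : X →ᵇ ℂ)
  hq : C.Reg q q₁
  hq₁ : C.Reg q₁ q₂
  hp : C.Reg p p₁
  hp₁ : C.Reg p₁ p₂
  div_q : C.Divisible q
  div_q₁ : C.Divisible q₁
  div_p₁ : C.Divisible p₁

namespace Jet

variable {C : ResolventCalculus μ} (J : C.Jet)

/-- The density `q p`. -/
def f : X →ᵇ ℂ := J.q * J.p

/-- The derivative of the density. -/
def f₁ : X →ᵇ ℂ := J.q₁ * J.p + J.q * J.p₁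

theorem hf : C.Reg J.f J.f₁ := J.hq.mul J.hp

theorem hf₁ :
    C.Reg J.f₁ (J.q₂ * J.p + J.q₁ * J.p₁ + (J.q₁ * J.p₁ + J.q * J.p₂)) :=
  (J.hq₁.mul J.hp).add (J.hq.mul J.hp₁)

theorem div_f : C.Divisible J.f := J.div_q.mul _

/-- The derivative of `f q`. -/
def g : X →ᵇ ℂ := J.f₁ * J.q + J.f * J.q₁

/-- The derivative of `f p`. -/
def h : X →ᵇ ℂ := J.f₁ * J.p + J.f * J.p₁

theorem hg : C.Reg (J.f * J.q) J.g := J.hf.mul J.hq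

theorem hh : C.Reg (J.f * J.p) J.h := J.hf.mul J.hp

/-- The second derivative of `f p`. -/
def h₁ : X →ᵇ ℂ :=
  (J.q₂ * J.p + J.q₁ * J.p₁ + (J.q₁ * J.p₁ + J.q * J.p₂)) * J.p + J.f₁ * J.p₁ +
    (J.f₁ * J.p₁ + J.f * J.p₂)

theorem hh₁ : C.Reg J.h J.h₁ :=
  (J.hf₁.mul J.hp).add (J.hf.mul J.hp₁)

/-- The operator `(∂ - κ)⁻¹ q (∂ + κ)⁻¹ p`. -/
def T (κ : ℝ) : Lp ℂ 2 μ →L[ℂ] Lp ℂ 2 μ := C.R (-κ) * M J.q * (C.R κ * M J.p)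

/-- The time derivative of `T` under the linear part of the flow. -/
def U (κ : ℝ) : Lp ℂ 2 μ →L[ℂ] Lp ℂ 2 μ :=
  Complex.I • (C.R (-κ) * M J.q₂ * (C.R κ * M J.p) - C.R (-κ) * M J.q * (C.R κ * M J.p₂))

/-- The time derivative of `T` under the nonlinear part of the flow. -/
def V (κ : ℝ) : Lp ℂ 2 μ →L[ℂ] Lp ℂ 2 μ :=
  -(C.R (-κ) * M J.g * (C.R κ * M J.p) + C.R (-κ) * M J.q * (C.R κ * M J.h))

/-- The trace of `N R f q R p`. -/
def traceX (κ : ℝ) (N : Lp ℂ 2 μ →L[ℂ] Lp ℂ 2 μ) : ℂ :=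
  trace (N * (C.R (-κ) * M (J.f * J.q) * (C.R κ * M J.p)))

/-- The trace of `N R q R p f`. -/
def traceY (κ : ℝ) (N : Lp ℂ 2 μ →L[ℂ] Lp ℂ 2 μ) : ℂ := trace (N * J.T κ * M J.f)

/-- The trace of `N R q R f R p`. -/
def traceS (κ : ℝ) (N : Lp ℂ 2 μ →L[ℂ] Lp ℂ 2 μ) (f : X →ᵇ ℂ) : ℂ :=
  trace (N * (C.R (-κ) * M J.q) * (C.R κ * M f) * (C.R κ * M J.p))

variable {κ : ℝ}

theorem reg_neg_pos (hκ : κ ≠ 0) {f f' : X →ᵇ ℂ} (hf : C.Reg f f') :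
    C.R (-κ) * M f' * C.R κ =
      M f * C.R κ - C.R (-κ) * M f + (2 * κ : ℂ) • (C.R (-κ) * M f * C.R κ) := by
  rw [C.der_comm hf.der (neg_ne_zero.mpr hκ) hκ]
  congr 2
  push_cast
  ring

theorem reg_pos_neg (hκ : κ ≠ 0) {f f' : X →ᵇ ℂ} (hf : C.Reg f f') :
    C.R κ * M f' * C.R (-κ) =
      M f * C.R (-κ) - C.R κ * M f - (2 * κ : ℂ) • (C.R κ * M f * C.R (-κ)) := by
  rw [C.der_comm hf.der hκ (neg_ne_zero.mpr hκ), sub_eq_add_neg _ ((2 * κ : ℂ) • _), ← neg_smul]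
  congr 2
  push_cast
  ring

theorem reg_same (hκ : κ ≠ 0) {f f' : X →ᵇ ℂ} (hf : C.Reg f f') :
    C.R κ * M f' * C.R κ = M f * C.R κ - C.R κ * M f := by
  rw [C.der_comm hf.der hκ hκ]
  simp

theorem T_mem (hκ : κ ≠ 0) : J.T κ ∈ TC (Lp ℂ 2 μ) :=
  mul_mem_TC (C.hs_left (neg_ne_zero.mpr hκ) J.hq.memLp) (C.hs_left hκ J.hp.memLp)

theorem traceS_add (hκ : κ ≠ 0) (N : Lp ℂ 2 μ →L[ℂ] Lp ℂ 2 μ) {f g : X →ᵇ ℂ}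
    (hf : MemLp f 2 μ) (hg : MemLp g 2 μ) :
    J.traceS κ N (f + g) = J.traceS κ N f + J.traceS κ N g := by
  have h : ∀ {k : X →ᵇ ℂ}, MemLp k 2 μ →
      N * (C.R (-κ) * M J.q) * (C.R κ * M k) * (C.R κ * M J.p) ∈ TC (Lp ℂ 2 μ) := fun hk =>
    TC_mul_right _ (mul_mem_TC
      (mul_mem_HS N (C.hs_left (neg_ne_zero.mpr hκ) J.hq.memLp)).1 (C.hs_left hκ hk))
  rw [traceS, traceS, traceS, ← trace_add (h hf) (h hg), mulOp_add]
  congr 1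
  noncomm_ring

theorem trace_resolvent_add (hκ : κ ≠ 0) (N : Lp ℂ 2 μ →L[ℂ] Lp ℂ 2 μ) (f g : X →ᵇ ℂ) :
    trace (N * J.T κ * (C.R (-κ) * M (f + g))) =
      trace (N * J.T κ * (C.R (-κ) * M f)) + trace (N * J.T κ * (C.R (-κ) * M g)) := by
  have h := TC_mul_left N (J.T_mem hκ)
  rw [← trace_add (TC_mul_right _ h) (TC_mul_right _ h), mulOp_add]
  congr 1
  noncomm_ring

/-- No cyclicity is used: the derivative lies between R(-κ) and R(κ), and N T makes each resulting
term trace class. -/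
theorem trace_der_left (hκ : κ ≠ 0) (N : Lp ℂ 2 μ →L[ℂ] Lp ℂ 2 μ) {f f' : X →ᵇ ℂ}
    (hf : C.Reg f f') :
    trace (N * J.T κ * (C.R (-κ) * M f' * (C.R κ * M J.p))) =
      J.traceS κ N (f * J.p) - trace (N * J.T κ * (C.R (-κ) * M (f * J.p))) +
        2 * κ * trace (N * J.T κ * (C.R (-κ) * M f * (C.R κ * M J.p))) := by
  have h := TC_mul_left N (J.T_mem hκ)
  have e : N * J.T κ * (C.R (-κ) * M f' * (C.R κ * M J.p)) =
      N * J.T κ * (M f * C.R κ * M J.p) - N * J.T κ * (C.R (-κ) * M (f * J.p)) +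
        (2 * κ : ℂ) • (N * J.T κ * (C.R (-κ) * M f * (C.R κ * M J.p))) := by
    calc _ = N * J.T κ * (C.R (-κ) * M f' * C.R κ) * M J.p := by noncomm_ring
      _ = _ := by
        rw [reg_neg_pos hκ hf, mulOp_mul]
        simp only [mul_add, add_mul, mul_sub, sub_mul, mul_smul_comm, smul_mul_assoc, mul_assoc]
  rw [e, trace_add (sub_mem (TC_mul_right _ h) (TC_mul_right _ h))
    (Submodule.smul_mem _ _ (TC_mul_right _ h)), trace_sub (TC_mul_right _ h) (TC_mul_right _ h),
    trace_smul]
  congr 2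
  rw [traceS, mul_comm f, mulOp_mul, T]
  noncomm_ring

variable {N : Lp ℂ 2 μ →L[ℂ] Lp ℂ 2 μ}

/-- The derivative is now the last factor, and the resolvent on its right is found by going around
the trace. As N commutes with T, N T begins with R(-κ), which can be rotated to the end. -/
theorem trace_der_right (hκ : κ ≠ 0) (hN : N * J.T κ = J.T κ * N) {g g' : X →ᵇ ℂ}
    (hg : C.Reg g g') :
    trace (N * J.T κ * (C.R (-κ) * M J.q * (C.R κ * M g'))) =
      trace (N * J.T κ * (C.R (-κ) * M (J.q * g))) - J.traceS κ N (J.q * g) -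
        2 * κ * trace (N * J.T κ * (C.R (-κ) * M J.q * (C.R κ * M g))) := by
  have hκ' := neg_ne_zero.mpr hκ
  set Z := M J.q * C.R κ * (M J.p * N) with hZ
  have hZm : Z ∈ HS (Lp ℂ 2 μ) := (HS_mul_mem _ (J.hq.hs_right hκ)).1
  have hZq : Z * (C.R (-κ) * M J.q) ∈ TC (Lp ℂ 2 μ) :=
    mul_mem_TC hZm (C.hs_left hκ' J.hq.memLp)
  have hNT : N * J.T κ = C.R (-κ) * Z := by rw [hN, hZ, T]; noncomm_ring
  have cyc : ∀ Y, trace (N * J.T κ * (C.R (-κ) * M J.q * Y)) =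
      trace (Z * (C.R (-κ) * M J.q) * (Y * C.R (-κ))) := by
    intro Y
    rw [hNT, mul_assoc, trace_comm_TC _ (by rw [← mul_assoc]; exact TC_mul_right _ hZq)]
    simp only [mul_assoc]
  have hS : trace (Z * (C.R (-κ) * M J.q) * (C.R κ * M g)) = J.traceS κ N (J.q * g) := by
    have h1 : C.R κ * M J.p * N * (C.R (-κ) * M J.q) * (C.R κ * M g) ∈ TC (Lp ℂ 2 μ) :=
      mul_mem_TC (mul_mem_HS _ (C.hs_left hκ' J.hq.memLp)).1 (C.hs_left hκ hg.memLp)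
    have h2 : N * (C.R (-κ) * M J.q) * (C.R κ * M g) * M J.q ∈ HS (Lp ℂ 2 μ) :=
      (HS_mul_mem _ (mul_mem_HS _ (C.hs_left hκ hg.memLp)).1).1
    calc _ = trace (M J.q * (C.R κ * M J.p * N * (C.R (-κ) * M J.q) * (C.R κ * M g))) := by
          rw [hZ]; simp only [mul_assoc]
      _ = trace (C.R κ * M J.p * (N * (C.R (-κ) * M J.q) * (C.R κ * M g) * M J.q)) := by
          rw [trace_comm_TC _ h1]; simp only [mul_assoc]
      _ = _ := by
          rw [trace_mul_comm (C.hs_left hκ J.hp.memLp) h2, traceS, mul_comm J.q g, mulOp_mul]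
          simp only [mul_assoc]
  have e0 : trace (N * J.T κ * (C.R (-κ) * M (J.q * g))) =
      trace (Z * (C.R (-κ) * M J.q) * (M g * C.R (-κ))) := by
    rw [← cyc, mulOp_mul]
    simp only [mul_assoc]
  rw [cyc, cyc, reg_pos_neg hκ hg, ← hS, e0, mul_sub, mul_sub, mul_smul_comm,
    trace_sub (sub_mem (TC_mul_right _ hZq) (TC_mul_right _ hZq))
      (Submodule.smul_mem _ _ (TC_mul_right _ hZq)),
    trace_sub (TC_mul_right _ hZq) (TC_mul_right _ hZq), trace_smul]

/-- With equal parameters R(κ) f' R(κ) is the bare commutator [f, R(κ)]; its two halves give X and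
Y. -/
theorem traceS_f₁ (hκ : κ ≠ 0) : J.traceS κ N J.f₁ = J.traceX κ N - J.traceY κ N := by
  have h : N * (C.R (-κ) * M (J.f * J.q) * (C.R κ * M J.p)) ∈ TC (Lp ℂ 2 μ) :=
    TC_mul_left _ (mul_mem_TC (C.hs_left (neg_ne_zero.mpr hκ) J.hg.memLp)
      (C.hs_left hκ J.hp.memLp))
  rw [traceX, traceY, ← trace_sub h (TC_mul_right _ (TC_mul_left _ (J.T_mem hκ))), traceS, T]
  congr 1
  calc _ = N * (C.R (-κ) * M J.q) * (C.R κ * M J.f₁ * C.R κ) * M J.p := by noncomm_ring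
    _ = N * C.R (-κ) * (M J.q * M J.f) * C.R κ * M J.p -
        N * C.R (-κ) * M J.q * C.R κ * (M J.f * M J.p) := by
      rw [reg_same hκ J.hf]
      noncomm_ring
    _ = _ := by
      rw [← mulOp_mul μ J.q, mul_comm J.q J.f, mulOp_comm μ J.f J.p]
      noncomm_ring

/-- Rotating the leading R(-κ) to the end creates R(-κ) f' R(-κ) = [f, R(-κ)]. -/
theorem trace_resolvent_f₁ (hκ : κ ≠ 0) (hN : N * J.T κ = J.T κ * N) :
    trace (N * J.T κ * (C.R (-κ) * M J.f₁)) = J.traceY κ N - J.traceX κ N := by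
  have hκ' := neg_ne_zero.mpr hκ
  set Z := M J.q * C.R κ * (M J.p * N) with hZ
  have hZm : Z ∈ HS (Lp ℂ 2 μ) := (HS_mul_mem _ (J.hq.hs_right hκ)).1
  have hNT : N * J.T κ = C.R (-κ) * Z := by rw [hN, hZ, T]; noncomm_ring
  have hRZ : C.R (-κ) * Z ∈ TC (Lp ℂ 2 μ) := hNT ▸ TC_mul_left N (J.T_mem hκ)
  have e1 : trace (Z * (M J.f * C.R (-κ))) = J.traceY κ N := by
    rw [trace_mul_comm hZm (J.hf.hs_right hκ'), mul_assoc, trace_comm_TC _ hRZ, ← hNT, traceY]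
  have e2 : trace (Z * (C.R (-κ) * M J.f)) = J.traceX κ N := by
    have h1 : M J.q * C.R κ * M J.p ∈ HS (Lp ℂ 2 μ) := (HS_mul_mem _ (J.hq.hs_right hκ)).1
    have h2 : N * (C.R (-κ) * M J.f) ∈ HS (Lp ℂ 2 μ) := (mul_mem_HS _ (C.hs_left hκ' J.hf.memLp)).1
    calc _ = trace (M J.q * C.R κ * M J.p * (N * (C.R (-κ) * M J.f))) := by
          rw [hZ]; simp only [mul_assoc]
      _ = _ := by
          rw [trace_mul_comm h1 h2, traceX, mulOp_mul]
          simp only [mul_assoc]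
  rw [hNT, mul_assoc, trace_comm_TC _ (mul_mem_TC hZm (C.hs_left hκ' J.hf.memLp')), mul_assoc,
    reg_same hκ' J.hf, mul_sub, trace_sub (mul_mem_TC hZm (J.hf.hs_right hκ'))
      (mul_mem_TC hZm (C.hs_left hκ' J.hf.memLp)), e1, e2]

/-- One integration by parts for each second derivative leaves `traceS` and resolvent terms at f' =
q₁ p + q p₁, each contributing X - Y. The 2κ terms cancel by integrating the first derivatives by
parts. -/
theorem trace_T_mul_U (hκ : κ ≠ 0) (hN : N * J.T κ = J.T κ * N) :
    trace (N * J.T κ * J.U κ) = 2 * Complex.I * (J.traceX κ N - J.traceY κ N) := by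
  have h := TC_mul_left N (J.T_mem hκ)
  have a1 := J.trace_der_left hκ N J.hq₁
  have a0 := J.trace_der_left hκ N J.hq
  have b1 := J.trace_der_right hκ hN J.hp₁
  have b0 := J.trace_der_right hκ hN J.hp
  have s := J.traceS_f₁ (N := N) hκ
  rw [f₁, J.traceS_add hκ N (memLp_mul μ J.hp.memLp) (memLp_mul μ J.hp.memLp')] at s
  have r := J.trace_resolvent_f₁ hκ hN
  rw [f₁, J.trace_resolvent_add hκ] at r
  rw [U, mul_smul_comm, trace_smul, mul_sub, trace_sub (TC_mul_right _ h) (TC_mul_right _ h)]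
  linear_combination Complex.I * (a1 - b1 + s - r + 2 * κ * (a0 + b0))

/-- Both boundary terms involve the same function f q p and cancel between the two halves of V; only
the 2κ terms survive. -/
theorem trace_T_mul_V (hκ : κ ≠ 0) (hN : N * J.T κ = J.T κ * N) :
    trace (N * J.T κ * J.V κ) =
      -(2 * κ * (J.traceX κ (N * J.T κ) - J.traceY κ (N * J.T κ))) := by
  have h := TC_mul_left N (J.T_mem hκ)
  have a := J.trace_der_left hκ N J.hg
  have b := J.trace_der_right hκ hN J.hh
  have e : J.f * J.q * J.p = J.q * (J.f * J.p) := by ring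
  have e2 : J.traceY κ (N * J.T κ) =
      trace (N * J.T κ * (C.R (-κ) * M J.q * (C.R κ * M (J.f * J.p)))) := by
    rw [traceY, mul_comm J.f, mulOp_mul]
    conv_lhs => rw [mul_assoc, T]
    simp only [T, mul_assoc]
  rw [e] at a
  rw [V, mul_neg, trace_neg, mul_add, trace_add (TC_mul_right _ h) (TC_mul_right _ h), e2, traceX]
  linear_combination -a - b

theorem trace_U (hκ : κ ≠ 0) : trace (J.U κ) = 0 := by
  have hκ' := neg_ne_zero.mpr hκ
  have i1 := trace_integrate_by_parts J.div_q₁ J.hq₁ J.hp J.hp₁ hκ' hκ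
  have i2 := trace_integrate_by_parts J.div_p₁ J.hp₁ J.hq J.hq₁ hκ hκ'
  rw [trace_mul_comm (C.hs_left hκ J.hp₁.memLp') (C.hs_left hκ' J.hq.memLp),
    trace_mul_comm (C.hs_left hκ J.hp₁.memLp) (C.hs_left hκ' J.hq₁.memLp)] at i2
  rw [U, trace_smul, trace_sub (mul_mem_TC (C.hs_left hκ' J.hq₁.memLp') (C.hs_left hκ J.hp.memLp))
    (mul_mem_TC (C.hs_left hκ' J.hq.memLp) (C.hs_left hκ J.hp₁.memLp'))]
  linear_combination Complex.I * (i1 - i2)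

/-- Here no factor T secures trace class, so the boundary terms must be grouped: they form [f²,
R(-κ)] and q R(κ) f' R(κ) p, both of trace zero. -/
theorem trace_V (hκ : κ ≠ 0) :
    trace (J.V κ) = -(2 * κ * (J.traceX κ 1 - J.traceY κ 1)) := by
  have hκ' := neg_ne_zero.mpr hκ
  have m1 := mul_mem_TC (C.hs_left hκ' J.hg.memLp') (C.hs_left hκ J.hp.memLp)
  have m2 := mul_mem_TC (C.hs_left hκ' J.hq.memLp) (C.hs_left hκ J.hh.memLp')
  have m3 := mul_mem_TC (J.hq.hs_right hκ) (J.hh₁.hs_right hκ')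
  have m4 := mul_mem_TC (C.hs_left hκ J.hf.memLp') (C.hs_left hκ J.hp.memLp)
  have m5 := mul_mem_TC (C.hs_left hκ' J.hg.memLp) (C.hs_left hκ J.hp.memLp)
  have m6 := mul_mem_TC (J.hq.hs_right hκ) (J.hh.hs_right hκ')
  have z := trace_commutator J.div_f J.hf J.hf J.hf₁ hκ'
  -- Rotation of q gives tr(R f' R f), and integrating f against itself by parts shows that twice
  -- this trace is zero.
  have z1 : trace (M J.q * (C.R κ * M J.f₁ * (C.R κ * M J.p))) = 0 := by
    have i := trace_integrate_by_parts J.div_f J.hf J.hf J.hf₁ hκ hκ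
    rw [trace_mul_comm (C.hs_left hκ J.hf.memLp) (C.hs_left hκ J.hf.memLp'), ← two_mul] at i
    rw [trace_comm_TC _ m4]
    have e : C.R κ * M J.f₁ * (C.R κ * M J.p) * M J.q = C.R κ * M J.f₁ * (C.R κ * M J.f) := by
      rw [f, mul_comm J.q, mulOp_mul]
      noncomm_ring
    rw [e]
    simpa using i
  have y : trace (M J.q * C.R κ * (M (J.f * J.p) * C.R (-κ))) = J.traceY κ 1 := by
    have h1 : M J.q * C.R κ * M J.p ∈ HS (Lp ℂ 2 μ) := (HS_mul_mem _ (J.hq.hs_right hκ)).1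
    calc _ = trace (M J.q * C.R κ * M J.p * (M J.f * C.R (-κ))) := by
          rw [mul_comm J.f, mulOp_mul]; simp only [mul_assoc]
      _ = trace (M J.f * J.T κ) := by
          rw [trace_mul_comm h1 (J.hf.hs_right hκ'), T]; simp only [mul_assoc]
      _ = _ := by rw [trace_comm_TC _ (J.T_mem hκ), traceY, one_mul]
  have e : C.R (-κ) * M J.g * (C.R κ * M J.p) + M J.q * C.R κ * (M J.h * C.R (-κ)) =
      M J.q * (C.R κ * M J.f₁ * (C.R κ * M J.p)) +
        (M (J.f * J.f) * C.R (-κ) - C.R (-κ) * M (J.f * J.f)) +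
        (2 * κ : ℂ) • (C.R (-κ) * M (J.f * J.q) * (C.R κ * M J.p) -
          M J.q * C.R κ * (M (J.f * J.p) * C.R (-κ))) := by
    have e1 : C.R (-κ) * M J.g * (C.R κ * M J.p) = C.R (-κ) * M J.g * C.R κ * M J.p := by
      noncomm_ring
    have e2 : M J.q * C.R κ * (M J.h * C.R (-κ)) = M J.q * (C.R κ * M J.h * C.R (-κ)) := by
      noncomm_ring
    have e3 : M J.q * (C.R κ * M J.f₁ * (C.R κ * M J.p)) =
      M J.q * (C.R κ * M J.f₁ * C.R κ) * M J.p := by noncomm_ring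
    have f1 : M (J.f * J.f) = M (J.f * J.q) * M J.p := by
      rw [← mulOp_mul]; congr 1; simp only [f]; ring
    have f2 : M (J.f * J.f) = M J.q * M (J.f * J.p) := by
      rw [← mulOp_mul]; congr 1; simp only [f]; ring
    have r1 : M (J.f * J.q) * (C.R κ * M J.p) = M J.q * (M J.f * (C.R κ * M J.p)) := by
      rw [mul_comm J.f, mulOp_mul, mul_assoc]
    have r2 : M J.q * (C.R κ * M (J.f * J.p)) = M J.q * (C.R κ * (M J.f * M J.p)) := by
      rw [mulOp_mul]
    have r3 : C.R (-κ) * (M (J.f * J.q) * M J.p) = C.R (-κ) * M (J.f * J.f) := by rw [f1]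
    have r4 : M J.q * (M (J.f * J.p) * C.R (-κ)) = M (J.f * J.f) * C.R (-κ) := by
      rw [f2, mul_assoc]
    rw [e1, e2, e3, reg_neg_pos hκ J.hg, reg_pos_neg hκ J.hh, reg_same hκ J.hf]
    simp only [add_mul, mul_sub, sub_mul, mul_smul_comm, smul_mul_assoc, smul_sub,
      mul_assoc]
    rw [r1, r2, r3, r4]
    abel
  rw [V, trace_neg, trace_add m1 m2, trace_rotate hκ hκ' J.hh₁ J.div_q,
    trace_mul_comm (J.hh₁.hs_right hκ') (J.hq.hs_right hκ), ← trace_add m1 m3, e,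
    trace_add (add_mem (TC_mul_left _ m4) (commutator_mem J.hf J.hf hκ'))
      (Submodule.smul_mem _ _ (sub_mem m5 m6)),
    trace_add (TC_mul_left _ m4) (commutator_mem J.hf J.hf hκ'), z1, z, trace_smul,
    trace_sub m5 m6, y, traceX, one_mul]
  ring

/-- `2κ (-iκ)ˡ (tr (T^(l-1) R f q R p) - tr (T^l f))`, and zero for `l = 0`. -/
def flux (κ : ℝ) : ℕ → ℂ
  | 0 => 0
  | l + 1 => 2 * κ * (-Complex.I * κ) ^ (l + 1) *
      (J.traceX κ (J.T κ ^ l) - J.traceY κ (J.T κ ^ l))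

/-- One factor -iκ turns the 2i of the dispersive part into 2κ, which matches the nonlinear part one
power lower. -/
theorem trace_pow_mul_eq_flux (hκ : κ ≠ 0) (l : ℕ) :
    (-Complex.I * κ) ^ (l + 1) * trace (J.T κ ^ l * (J.U κ + J.V κ)) =
      J.flux κ l - J.flux κ (l + 1) := by
  have hκ' := neg_ne_zero.mpr hκ
  have mU : J.U κ ∈ TC (Lp ℂ 2 μ) := Submodule.smul_mem _ _ (sub_mem
    (mul_mem_TC (C.hs_left hκ' J.hq₁.memLp') (C.hs_left hκ J.hp.memLp))
    (mul_mem_TC (C.hs_left hκ' J.hq.memLp) (C.hs_left hκ J.hp₁.memLp')))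
  have mV : J.V κ ∈ TC (Lp ℂ 2 μ) := neg_mem (add_mem
    (mul_mem_TC (C.hs_left hκ' J.hg.memLp') (C.hs_left hκ J.hp.memLp))
    (mul_mem_TC (C.hs_left hκ' J.hq.memLp) (C.hs_left hκ J.hh.memLp')))
  rw [mul_add, trace_add (TC_mul_left _ mU) (TC_mul_left _ mV)]
  cases l with
  | zero =>
    rw [pow_zero, one_mul, one_mul, J.trace_U hκ, J.trace_V hκ]
    simp only [flux, pow_zero]
    ring
  | succ l =>
    have hN : J.T κ ^ l * J.T κ = J.T κ * J.T κ ^ l := by rw [← pow_succ, ← pow_succ']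
    simp only [flux]
    rw [pow_succ (J.T κ), J.trace_T_mul_U hκ hN, J.trace_T_mul_V hκ hN]
    linear_combination (-2 * κ * (-Complex.I * κ) ^ (l + 1) *
      (J.traceX κ (J.T κ ^ l) - J.traceY κ (J.T κ ^ l))) * Complex.I_sq

end Jet

end ResolventCalculus

end DNLS

end

noncomputable section

namespace DNLS

/-! ### The normed space of Hilbert-Schmidt operators -/

section HSSpace

variable (H : Type*) [NormedAddCommGroup H] [InnerProductSpace ℂ H] [CompleteSpace H]

/-- The Hilbert-Schmidt operators, with the Hilbert-Schmidt norm. -/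
def HSSpace : Type _ := HS H

instance : AddCommGroup (HSSpace H) := inferInstanceAs (AddCommGroup (HS H))

instance : Module ℂ (HSSpace H) := inferInstanceAs (Module ℂ (HS H))

/-- The embedding of the Hilbert-Schmidt operators into square summable families. -/
def HSSpace.seq : HSSpace H →ₗ[ℂ] lp (fun _ : basisSet H => H) 2 := hsSeq H

/-- The norm is pulled back from the square summable families. The type synonym keeps it apart from
the operator norm of the submodule `HS H`. -/
instance : NormedAddCommGroup (HSSpace H) :=
  NormedAddCommGroup.induced (HSSpace H) _ (HSSpace.seq H) (hsSeq_injective H)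

instance : NormedSpace ℂ (HSSpace H) := NormedSpace.induced ℂ (HSSpace H) _ (HSSpace.seq H)

variable {H}

/-- A Hilbert-Schmidt operator as an element of `HSSpace`. -/
def HSSpace.mk (A : H →L[ℂ] H) (hA : A ∈ HS H) : HSSpace H := ⟨A, hA⟩

/-- The operator given by an element of `HSSpace`. -/
def HSSpace.op (A : HSSpace H) : H →L[ℂ] H := A.1

theorem HSSpace.mem (A : HSSpace H) : A.op ∈ HS H := A.2

theorem HSSpace.norm_eq (A : HSSpace H) : ‖A‖ = hsNorm A.op := norm_hsSeq A

@[ext]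
theorem HSSpace.ext {A B : HSSpace H} (h : A.op = B.op) : A = B := Subtype.ext h

@[simp]
theorem HSSpace.op_mk (A : H →L[ℂ] H) (hA : A ∈ HS H) : (HSSpace.mk A hA).op = A := rfl

@[simp]
theorem HSSpace.op_add (A B : HSSpace H) : (A + B).op = A.op + B.op := rfl

@[simp]
theorem HSSpace.op_smul (c : ℂ) (A : HSSpace H) : (c • A).op = c • A.op := rfl

variable (H) in
/-- The inclusion of the Hilbert-Schmidt operators into the bounded operators. -/
def HSSpace.incl : HSSpace H →L[ℂ] (H →L[ℂ] H) :=
  LinearMap.mkContinuous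
    { toFun := HSSpace.op
      map_add' := fun _ _ => rfl
      map_smul' := fun _ _ => rfl } 1 fun A => by
    rw [one_mul, A.norm_eq]
    exact norm_le_hsNorm A.mem

variable (H) in
/-- The composition of a bounded and a Hilbert-Schmidt operator. -/
def HSSpace.mulLeft : (H →L[ℂ] H) →L[ℂ] HSSpace H →L[ℂ] HSSpace H :=
  LinearMap.mkContinuous₂
    (LinearMap.mk₂ ℂ (fun N A => HSSpace.mk (N * A.op) (mul_mem_HS N A.mem).1)
      (fun _ _ _ => HSSpace.ext (add_mul _ _ _)) (fun _ _ _ => HSSpace.ext (smul_mul_assoc _ _ _))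
      (fun _ _ _ => HSSpace.ext (mul_add _ _ _)) (fun _ _ _ => HSSpace.ext (mul_smul_comm _ _ _)))
    1 fun N A => by
      rw [one_mul, HSSpace.norm_eq, HSSpace.norm_eq]
      exact (mul_mem_HS N A.mem).2

variable (H) in
/-- The bilinear form `tr (A B)`. -/
def HSSpace.traceMul : HSSpace H →L[ℂ] HSSpace H →L[ℂ] ℂ :=
  LinearMap.mkContinuous₂
    (LinearMap.mk₂ ℂ (fun A B => trace (A.op * B.op))
      (fun A A' B => by
        rw [HSSpace.op_add, add_mul, trace_add (mul_mem_TC A.mem B.mem) (mul_mem_TC A'.mem B.mem)])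
      (fun c A B => by rw [HSSpace.op_smul, smul_mul_assoc, trace_smul, smul_eq_mul])
      (fun A B B' => by
        rw [HSSpace.op_add, mul_add, trace_add (mul_mem_TC A.mem B.mem) (mul_mem_TC A.mem B'.mem)])
      (fun c A B => by rw [HSSpace.op_smul, mul_smul_comm, trace_smul, smul_eq_mul]))
    1 fun A B => by
      rw [one_mul, A.norm_eq, B.norm_eq]
      exact norm_trace_mul_le A.mem B.mem

theorem norm_trace_mul_mul_le (N : H →L[ℂ] H) {A B : H →L[ℂ] H} (hA : A ∈ HS H) (hB : B ∈ HS H) :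
    ‖trace (N * (A * B))‖ ≤ ‖N‖ * (hsNorm A * hsNorm B) := by
  rw [← mul_assoc, ← mul_assoc]
  exact (norm_trace_mul_le (mul_mem_HS N hA).1 hB).trans
    (mul_le_mul_of_nonneg_right (mul_mem_HS N hA).2 (hsNorm_nonneg _))

/-! ### Traces of powers along a differentiable curve -/

/-- The derivative Σ Tⁱ T' Tʲ does not simplify, but under the trace its terms coincide. The
exponent m + 1 provides a factor T, so that D T is trace class with nothing known about D. -/
theorem exists_hasDerivAt_pow {T : ℝ → H →L[ℂ] H} {T' : H →L[ℂ] H} {t : ℝ}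
    (hT : HasDerivAt T T' t) (hTm : T t ∈ TC H) (hT' : T' ∈ TC H) (n : ℕ) :
    ∃ D : H →L[ℂ] H, HasDerivAt (fun s => T s ^ n) D t ∧
      ∀ m : ℕ, trace (D * T t ^ (m + 1)) = n * trace (T t ^ (n + m) * T') := by
  induction n with
  | zero => exact ⟨0, by simpa using hasDerivAt_const t (1 : H →L[ℂ] H), by simp [trace_zero]⟩
  | succ n ih =>
    obtain ⟨D, hD, hDm⟩ := ih
    refine ⟨D * T t + T t ^ n * T', by simpa only [pow_succ] using! hD.mul hT, fun m => ?_⟩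
    have h1 : T t ^ n * T' ∈ TC H := TC_mul_left _ hT'
    have h2 : D * T t ∈ TC H := TC_mul_left _ hTm
    rw [add_mul, trace_add (TC_mul_right _ h2) (TC_mul_right _ h1), ← trace_comm_TC _ h1,
      ← mul_assoc (T t ^ (m + 1)), ← pow_add, mul_assoc D, ← pow_succ', hDm (m + 1)]
    rw [show n + (m + 1) = n + 1 + m by ring, show m + 1 + n = n + 1 + m by ring]
    push_cast
    ring

/-- With (AB)^(n+1) = ((AB)^n A) B, the power is differentiated in operator norm, while A and B are
differentiated in Hilbert-Schmidt norm, for which the trace pairing is continuous. -/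
theorem hasDerivAt_trace_pow {A B : ℝ → HSSpace H} {A' B' : HSSpace H} {t : ℝ}
    (hA : HasDerivAt A A' t) (hB : HasDerivAt B B' t) (n : ℕ) :
    HasDerivAt (fun s => trace (((A s).op * (B s).op) ^ (n + 1)))
      ((n + 1) * trace (((A t).op * (B t).op) ^ n * (A'.op * (B t).op + (A t).op * B'.op))) t := by
  have hA0 : HasDerivAt (fun s => (A s).op) A'.op t :=
    ((HSSpace.incl H).restrictScalars ℝ).hasFDerivAt.comp_hasDerivAt t hA
  have hB0 : HasDerivAt (fun s => (B s).op) B'.op t :=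
    ((HSSpace.incl H).restrictScalars ℝ).hasFDerivAt.comp_hasDerivAt t hB
  have m1 := mul_mem_TC A'.mem (B t).mem
  have m2 := mul_mem_TC (A t).mem B'.mem
  have m3 := mul_mem_TC (A t).mem (B t).mem
  obtain ⟨D, hD, hDm⟩ := exists_hasDerivAt_pow (hA0.mul hB0) m3 (add_mem m1 m2) n
  have h1 := ((HSSpace.mulLeft H).bilinearRestrictScalars ℝ).hasFDerivAt_of_bilinear
    hD.hasFDerivAt hA.hasFDerivAt
  have h2 := ((HSSpace.traceMul H).bilinearRestrictScalars ℝ).hasFDerivAt_of_bilinear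
    h1 hB.hasFDerivAt
  have h3 := h2.hasDerivAt
  refine (h3.congr_deriv ?_).congr_of_eventuallyEq (Eventually.of_forall fun s => ?_)
  · have e := hDm 0
    rw [zero_add, pow_one, add_zero] at e
    simp only [Pi.mul_apply] at e
    have e2 : trace (D * (A t).op * (B t).op) = n * trace (((A t).op * (B t).op) ^ n *
        (A'.op * (B t).op + (A t).op * B'.op)) := by rw [← e, mul_assoc]
    have e3 : trace (((A t).op * (B t).op) ^ n * (A'.op * (B t).op + (A t).op * B'.op)) =
        trace (((A t).op * (B t).op) ^ n * A'.op * (B t).op) +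
          trace (((A t).op * (B t).op) ^ n * (A t).op * B'.op) := by
      rw [mul_add, trace_add (TC_mul_left _ m1) (TC_mul_left _ m2), mul_assoc, mul_assoc]
    simp [HSSpace.mulLeft, HSSpace.traceMul]
    linear_combination e2 - e3
  · simp only [HSSpace.mulLeft, HSSpace.traceMul, Pi.mul_apply,
      ContinuousLinearMap.bilinearRestrictScalars_apply_apply, LinearMap.mkContinuous₂_apply,
      LinearMap.mk₂_apply, HSSpace.op_mk]
    rw [pow_succ, mul_assoc]

end HSSpace

end DNLS

end

noncomputable section

namespace DNLS

namespace ResolventCalculus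

variable {X : Type*} [TopologicalSpace X] [MeasurableSpace X] [BorelSpace X] {μ : Measure X}

local notation "M" => mulOp μ

/-! ### Integration by parts in `L²` -/

variable {C : ResolventCalculus μ}

theorem Reg.integrable_mul {f f' g g' : X →ᵇ ℂ} (hf : C.Reg f f') (hg : C.Reg g g') :
    Integrable (f' * g + f * g' : X →ᵇ ℂ) μ :=
  (hf.memLp'.integrable_mul hg.memLp).add (hf.memLp.integrable_mul hg.memLp')

theorem Reg.integral_mul {f f' g g' : X →ᵇ ℂ} (hf : C.Reg f f') (hg : C.Reg g g') :
    ∫ x, (f' * g + f * g' : X →ᵇ ℂ) x ∂μ = 0 :=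
  C.integral_der (C.der_mul hf.der hg.der) (hf.memLp.integrable_mul hg.memLp) (hf.integrable_mul hg)

/-! ### Differentiable curves of coefficients -/

/-- Transfers differentiability through f ↦ R f and conjugation, which are given here on bounded
continuous representatives and not as maps on L²: a bound on the remainders is enough. -/
theorem hasDerivAt_of_norm_le {E F : Type*} [NormedAddCommGroup E] [NormedSpace ℝ E]
    [NormedAddCommGroup F] [NormedSpace ℝ F] {u : ℝ → E} {u' : E} {v : ℝ → F} {v' : F} {t : ℝ}
    {c : ℝ} (h : ∀ s, ‖v s - v t - (s - t) • v'‖ ≤ c * ‖u s - u t - (s - t) • u'‖)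
    (hu : HasDerivAt u u' t) : HasDerivAt v v' t := by
  rw [hasDerivAt_iff_isLittleO] at hu ⊢
  exact (Asymptotics.IsBigO.of_bound c (Eventually.of_forall h)).trans_isLittleO hu

omit [BorelSpace X] in
theorem toLp_remainder {k : ℝ → X →ᵇ ℂ} (hk : ∀ s, MemLp (k s) 2 μ) {k' : X →ᵇ ℂ}
    (hk' : MemLp k' 2 μ) (s t : ℝ) :
    ∃ h : MemLp (k s - k t - ((s - t : ℝ) : ℂ) • k' : X →ᵇ ℂ) 2 μ,
      h.toLp = (hk s).toLp - (hk t).toLp - (s - t) • hk'.toLp := by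
  refine ⟨((hk s).sub (hk t)).sub (hk'.const_smul _), ?_⟩
  have : (s - t) • hk'.toLp = ((s - t : ℝ) : ℂ) • hk'.toLp := by
    rw [← MemLp.toLp_const_smul, ← MemLp.toLp_const_smul]
    congr 1
  rw [this]
  rfl

omit [BorelSpace X] in
theorem hasDerivAt_star {k : ℝ → X →ᵇ ℂ} (hk : ∀ s, MemLp (k s) 2 μ) {k' : X →ᵇ ℂ}
    (hk' : MemLp k' 2 μ) {t : ℝ} (h : HasDerivAt (fun s => (hk s).toLp) hk'.toLp t) :
    HasDerivAt (fun s => (memLp_star μ (hk s)).toLp) (memLp_star μ hk').toLp t := by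
  refine hasDerivAt_of_norm_le (c := 1) (fun s => ?_) h
  obtain ⟨h1, e1⟩ := toLp_remainder hk hk' s t
  obtain ⟨h2, e2⟩ := toLp_remainder (fun s => memLp_star μ (hk s)) (memLp_star μ hk') s t
  rw [← e1, ← e2, one_mul, Lp.norm_toLp, Lp.norm_toLp]
  refine (congrArg _ (eLpNorm_congr_norm_ae (Eventually.of_forall fun x => ?_))).le
  rw [← norm_star]
  simp

variable (C) in
/-- The Hilbert-Schmidt operator `R f`. -/
def hsOp {a : ℝ} (ha : a ≠ 0) {f : X →ᵇ ℂ} (hf : MemLp f 2 μ) : HSSpace (Lp ℂ 2 μ) :=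
  HSSpace.mk (C.R a * M f) (C.hs_left ha hf)

theorem norm_hsOp_le {a : ℝ} (ha : a ≠ 0) {f : X →ᵇ ℂ} (hf : MemLp f 2 μ) :
    ‖C.hsOp ha hf‖ ≤ C.hsConst a * ‖hf.toLp‖ := by
  rw [HSSpace.norm_eq]
  exact (C.hs ha hf).2

theorem hasDerivAt_hsOp {a : ℝ} (ha : a ≠ 0) {k : ℝ → X →ᵇ ℂ} (hk : ∀ s, MemLp (k s) 2 μ)
    {k' : X →ᵇ ℂ} (hk' : MemLp k' 2 μ) {t : ℝ}
    (h : HasDerivAt (fun s => (hk s).toLp) hk'.toLp t) :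
    HasDerivAt (fun s => C.hsOp ha (hk s)) (C.hsOp ha hk') t := by
  refine hasDerivAt_of_norm_le (c := C.hsConst a) (fun s => ?_) h
  obtain ⟨h1, e1⟩ := toLp_remainder hk hk' s t
  rw [← e1]
  convert! norm_hsOp_le ha h1 using 2
  apply HSSpace.ext
  change _ - _ - ((s - t : ℝ) : ℂ) • _ = _
  simp only [hsOp, HSSpace.op_mk]
  rw [mulOp_sub, mulOp_sub, mulOp_smul, mul_sub, mul_sub, mul_smul_comm]
  rfl

/-! ### Solutions of the derivative nonlinear Schrödinger equation -/

/-- A curve of coefficients with two derivatives in `L²`, differentiable in `L²` with respect to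
time, that solves the derivative nonlinear Schrödinger equation. -/
structure Solution (C : ResolventCalculus μ) where
  (q q₁ q₂ : ℝ → X →ᵇ ℂ)
  hq : ∀ s, C.Reg (q s) (q₁ s)
  hq₁ : ∀ s, C.Reg (q₁ s) (q₂ s)
  div_q : ∀ s, C.Divisible (q s)
  div_q₁ : ∀ s, C.Divisible (q₁ s)
  div_star_q₁ : ∀ s, C.Divisible (star (q₁ s))
  qt : ℝ → X →ᵇ ℂ
  memLp_qt : ∀ s, MemLp (qt s) 2 μ
  hasDerivAt : ∀ s, HasDerivAt (fun r => (hq r).memLp.toLp) (memLp_qt s).toLp s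
  continuous_qt : Continuous fun s => (memLp_qt s).toLp
  eqn : ∀ s, qt s = Complex.I • q₂ s -
    ((q₁ s * star (q s) + q s * star (q₁ s)) * q s + q s * star (q s) * q₁ s)

/-! ### Conservation of the L² norm and of α for an abstract solution -/

namespace Solution

variable (S : C.Solution)

/-- The coefficients at a fixed time. -/
def jet (s : ℝ) : C.Jet where
  q := S.q s
  q₁ := S.q₁ s
  q₂ := S.q₂ s
  p := star (S.q s)
  p₁ := star (S.q₁ s)
  p₂ := star (S.q₂ s)
  hq := S.hq s
  hq₁ := S.hq₁ s
  hp := (S.hq s).star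
  hp₁ := (S.hq₁ s).star
  div_q := S.div_q s
  div_q₁ := S.div_q₁ s
  div_p₁ := S.div_star_q₁ s

theorem qt_eq (s : ℝ) : S.qt s = Complex.I • S.q₂ s - (S.jet s).g := S.eqn s

theorem star_qt_eq (s : ℝ) : star (S.qt s) = -(Complex.I • star (S.q₂ s)) - (S.jet s).h := by
  rw [S.qt_eq]
  ext x
  simp [jet, Jet.g, Jet.h, Jet.f, Jet.f₁]
  ring

/-- The solution as a curve in `L²`. -/
def u (s : ℝ) : Lp ℂ 2 μ := (S.hq s).memLp.toLp

/-- The density is exact: ∂ₜ(q̄ q) = i (q̄ q')' - i (q q̄')' - (3/2)(f²)'. -/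
theorem inner_add_inner_eq_zero (s : ℝ) :
    inner ℂ (S.u s) (S.memLp_qt s).toLp + inner ℂ (S.memLp_qt s).toLp (S.u s) = 0 := by
  set J := S.jet s with hJ
  have i1 := (J.hp.integrable_mul J.hq₁)
  have i2 := (J.hq.integrable_mul J.hp₁)
  have i3 := (J.hf.integrable_mul J.hf)
  have e1 := (J.hp.integral_mul J.hq₁)
  have e2 := (J.hq.integral_mul J.hp₁)
  have e3 := (J.hf.integral_mul J.hf)
  have : inner ℂ (S.u s) (S.memLp_qt s).toLp + inner ℂ (S.memLp_qt s).toLp (S.u s) =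
      ∫ x, (Complex.I * (J.p₁ * J.q₁ + J.p * J.q₂ : X →ᵇ ℂ) x -
        Complex.I * (J.q₁ * J.p₁ + J.q * J.p₂ : X →ᵇ ℂ) x -
        (3 / 2) * (J.f₁ * J.f + J.f * J.f₁ : X →ᵇ ℂ) x) ∂μ := by
    rw [L2.inner_def, L2.inner_def, ← integral_add (L2.integrable_inner _ _)
      (L2.integrable_inner _ _)]
    refine integral_congr_ae ?_
    filter_upwards [(S.hq s).memLp.coeFn_toLp, (S.memLp_qt s).coeFn_toLp] with x h1 h2
    have h3 : S.u s x = S.q s x := h1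
    have h4 : (starRingEnd ℂ) (S.qt s x) = (star (S.qt s)) x := rfl
    simp only [RCLike.inner_apply, h2, h3]
    rw [h4, S.star_qt_eq, S.qt_eq]
    simp [hJ, jet, Jet.g, Jet.h, Jet.f, Jet.f₁]
    ring
  have h1 := integral_sub (i1.const_mul Complex.I) (i2.const_mul Complex.I)
  have h2 := integral_sub ((i1.const_mul Complex.I).sub (i2.const_mul Complex.I))
    (i3.const_mul (3 / 2))
  simp only [Pi.sub_apply] at h2
  rw [this, h2, h1, integral_const_mul, integral_const_mul,
    integral_const_mul, e1, e2, e3]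
  simp

theorem norm_u_eq (s t : ℝ) : ‖S.u s‖ = ‖S.u t‖ := by
  have hd : ∀ s, HasDerivAt (fun r => inner ℂ (S.u r) (S.u r)) 0 s := by
    intro s
    convert! (S.hasDerivAt s).inner ℂ (S.hasDerivAt s) using 1
    exact (S.inner_add_inner_eq_zero s).symm
  have hc := is_const_of_deriv_eq_zero (fun s => (hd s).differentiableAt) (fun s => (hd s).deriv) s t
  simp only [inner_self_eq_norm_sq_to_K] at hc
  have hc' : ‖S.u s‖ ^ 2 = ‖S.u t‖ ^ 2 := by exact_mod_cast hc
  exact (pow_left_inj₀ (norm_nonneg _) (norm_nonneg _) two_ne_zero).mp hc'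

/-- The operator `(∂ - κ)⁻¹ q (∂ + κ)⁻¹ q̄` at a fixed time. -/
def T (κ : ℝ) (s : ℝ) : Lp ℂ 2 μ →L[ℂ] Lp ℂ 2 μ := (S.jet s).T κ

variable {κ : ℝ}

theorem norm_star_u (s : ℝ) : ‖(memLp_star μ (S.hq s).memLp).toLp‖ = ‖S.u s‖ := by
  rw [u, Lp.norm_toLp, Lp.norm_toLp]
  exact congrArg _ (eLpNorm_congr_norm_ae (Eventually.of_forall fun x => by simp))

theorem norm_star_qt (s : ℝ) :
    ‖(memLp_star μ (S.memLp_qt s)).toLp‖ = ‖(S.memLp_qt s).toLp‖ := by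
  rw [Lp.norm_toLp, Lp.norm_toLp]
  exact congrArg _ (eLpNorm_congr_norm_ae (Eventually.of_forall fun x => by simp))

/-- The smallness condition under which the series converges. -/
def Small (κ : ℝ) : Prop := κ * (C.hsConst (-κ) * ‖S.u 0‖ * (C.hsConst κ * ‖S.u 0‖)) ≤ 1 / 2

theorem isTraceClass_pow (hκ : κ ≠ 0) (s : ℝ) (l : ℕ) (hl : 1 ≤ l) : IsTraceClass (S.T κ s ^ l) := by
  obtain ⟨l, rfl⟩ := Nat.exists_eq_add_of_le' hl
  refine ⟨S.T κ s ^ l * (C.R (-κ) * M (S.q s)), C.R κ * M (star (S.q s)), ?_, ?_, ?_⟩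
  · exact isHilbertSchmidt_of_mem
      (mul_mem_HS _ (C.hs_left (neg_ne_zero.mpr hκ) (S.hq s).memLp)).1
  · exact isHilbertSchmidt_of_mem (C.hs_left hκ (memLp_star μ (S.hq s).memLp))
  · rw [pow_succ]
    exact (mul_assoc _ _ _).symm

theorem hs_bounds (hκ : κ ≠ 0) (s : ℝ) :
    hsNorm (C.R (-κ) * M (S.q s)) ≤ C.hsConst (-κ) * ‖S.u 0‖ ∧
      hsNorm (C.R κ * M (star (S.q s))) ≤ C.hsConst κ * ‖S.u 0‖ := by
  rw [S.norm_u_eq 0 s]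
  refine ⟨(C.hs (neg_ne_zero.mpr hκ) (S.hq s).memLp).2, ?_⟩
  rw [← S.norm_star_u s]
  exact (C.hs hκ (memLp_star μ (S.hq s).memLp)).2

theorem hs_prod_le (hκ : 0 < κ) (hS : S.Small κ) (s : ℝ) :
    κ * (hsNorm (C.R (-κ) * M (S.q s)) * hsNorm (C.R κ * M (star (S.q s)))) ≤ 1 / 2 := by
  refine le_trans (mul_le_mul_of_nonneg_left ?_ hκ.le) hS
  obtain ⟨h1, h2⟩ := S.hs_bounds hκ.ne' s
  exact mul_le_mul h1 h2 (hsNorm_nonneg _) ((hsNorm_nonneg _).trans h1)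

theorem norm_T_le (hκ : 0 < κ) (hS : S.Small κ) (s : ℝ) : κ * ‖S.T κ s‖ ≤ 1 / 2 := by
  refine le_trans (mul_le_mul_of_nonneg_left ?_ hκ.le) (S.hs_prod_le hκ hS s)
  refine (norm_mul_le _ _).trans (mul_le_mul (norm_le_hsNorm ?_) (norm_le_hsNorm ?_)
    (norm_nonneg _) (hsNorm_nonneg _))
  · exact C.hs_left (neg_ne_zero.mpr hκ.ne') (S.hq s).memLp
  · exact C.hs_left hκ.ne' (memLp_star μ (S.hq s).memLp)

theorem norm_pow_mul_trace_le (hκ : 0 < κ) (hS : S.Small κ) (s : ℝ) (l : ℕ)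
    {A B : Lp ℂ 2 μ →L[ℂ] Lp ℂ 2 μ} (hA : A ∈ HS (Lp ℂ 2 μ)) (hB : B ∈ HS (Lp ℂ 2 μ)) :
    ‖(-Complex.I * κ) ^ (l + 1) * trace (S.T κ s ^ l * (A * B))‖ ≤
      κ * (hsNorm A * hsNorm B) * (1 / 2) ^ l := by
  have hn : ‖(-Complex.I * κ : ℂ)‖ = κ := by simp [abs_of_pos hκ]
  rw [norm_mul, norm_pow, hn]
  have h0 : 0 ≤ hsNorm A * hsNorm B := mul_nonneg (hsNorm_nonneg _) (hsNorm_nonneg _)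
  have h1 : ‖S.T κ s ^ l‖ ≤ ‖S.T κ s‖ ^ l := by
    cases l with
    | zero =>
      rw [pow_zero, pow_zero]
      -- Only ‖1‖ ≤ 1 is available, since L²(μ) may be trivial.
      exact ContinuousLinearMap.norm_id_le
    | succ l => exact norm_pow_le' _ l.succ_pos
  calc κ ^ (l + 1) * ‖trace (S.T κ s ^ l * (A * B))‖
      ≤ κ ^ (l + 1) * (‖S.T κ s‖ ^ l * (hsNorm A * hsNorm B)) := by
        gcongr
        exact (norm_trace_mul_mul_le _ hA hB).trans (mul_le_mul_of_nonneg_right h1 h0)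
    _ = κ * (hsNorm A * hsNorm B) * (κ * ‖S.T κ s‖) ^ l := by ring
    _ ≤ _ := by
        gcongr
        exact S.norm_T_le hκ hS s

-- This form of the coefficient shows that the factor l + 1 from differentiating the power cancels
-- the denominator.
omit [TopologicalSpace X] [BorelSpace X] in
theorem detTerm_eq (κ : ℝ) (T : Lp ℂ 2 μ →L[ℂ] Lp ℂ 2 μ) (l : ℕ) :
    detTerm κ T (l + 1) =
      Complex.I / (l + 1) * ((-Complex.I * κ) ^ (l + 1) * trace (T ^ (l + 1))) := by
  rw [detTerm, neg_mul, neg_pow (Complex.I * (κ : ℂ)), mul_pow, pow_succ Complex.I (l + 1)]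
  push_cast
  ring

theorem summable_detTerm (hκ : 0 < κ) (hS : S.Small κ) (s : ℝ) :
    Summable fun l => detTerm κ (S.T κ s) (l + 1) := by
  have m1 := C.hs_left (neg_ne_zero.mpr hκ.ne') (S.hq s).memLp
  have m2 := C.hs_left hκ.ne' (memLp_star μ (S.hq s).memLp)
  refine Summable.of_norm_bounded (g := fun l : ℕ => κ * (hsNorm (C.R (-κ) * M (S.q s)) *
    hsNorm (C.R κ * M (star (S.q s)))) * (1 / 2) ^ l)
    ((summable_geometric_of_lt_one (by norm_num) (by norm_num)).mul_left _) fun l => ?_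
  rw [detTerm_eq, norm_mul, pow_succ (S.T κ s)]
  refine (mul_le_of_le_one_left (norm_nonneg _) ?_).trans
    (S.norm_pow_mul_trace_le hκ hS s l m1 m2)
  rw [norm_div, Complex.norm_I]
  have : ‖(l + 1 : ℂ)‖ = l + 1 := by exact_mod_cast Complex.norm_natCast (l + 1)
  rw [this]
  exact (div_le_one (by positivity)).mpr (by linarith [(Nat.cast_nonneg l : (0 : ℝ) ≤ l)])

theorem tendsto_flux (hκ : 0 < κ) (hS : S.Small κ) (s : ℝ) :
    Tendsto ((S.jet s).flux κ) atTop (𝓝 0) := by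
  set J := S.jet s with hJ
  have hκ' := neg_ne_zero.mpr hκ.ne'
  have m1 := C.hs_left hκ' J.hg.memLp
  have m2 := C.hs_left hκ.ne' J.hp.memLp
  have m3 := C.hs_left hκ' J.hq.memLp
  -- In `traceY` the trailing f joins the right-hand Hilbert-Schmidt factor.
  have m4 : C.R κ * M J.p * M J.f ∈ HS (Lp ℂ 2 μ) := (HS_mul_mem _ m2).1
  rw [← tendsto_add_atTop_iff_nat 1]
  set K := κ * (hsNorm (C.R (-κ) * M (J.f * J.q)) * hsNorm (C.R κ * M J.p))
  set L := κ * (hsNorm (C.R (-κ) * M J.q) * hsNorm (C.R κ * M J.p * M J.f))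
  have hlim : Tendsto (fun l : ℕ => 2 * κ * (K * (1 / 2) ^ l + L * (1 / 2) ^ l)) atTop (𝓝 0) := by
    have h := tendsto_pow_atTop_nhds_zero_of_lt_one (r := (1 / 2 : ℝ)) (by norm_num) (by norm_num)
    simpa using ((h.const_mul K).add (h.const_mul L)).const_mul (2 * κ)
  refine squeeze_zero_norm (fun l => ?_) hlim
  have b1 := S.norm_pow_mul_trace_le hκ hS s l m1 m2
  have b2 := S.norm_pow_mul_trace_le hκ hS s l m3 m4
  have e : J.flux κ (l + 1) = (2 * κ : ℂ) * ((-Complex.I * κ) ^ (l + 1) *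
      trace (S.T κ s ^ l * (C.R (-κ) * M (J.f * J.q) * (C.R κ * M J.p))) -
      (-Complex.I * κ) ^ (l + 1) *
        trace (S.T κ s ^ l * (C.R (-κ) * M J.q * (C.R κ * M J.p * M J.f)))) := by
    have h : J.traceY κ (J.T κ ^ l) =
        trace (S.T κ s ^ l * (C.R (-κ) * M J.q * (C.R κ * M J.p * M J.f))) := by
      rw [Jet.traceY]
      simp only [T, ← hJ, Jet.T, mul_assoc]
    simp only [Jet.flux]
    rw [h, Jet.traceX]
    simp only [T, ← hJ]
    ring
  rw [e, norm_mul]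
  have hn : ‖(2 * κ : ℂ)‖ = 2 * κ := by simp [abs_of_pos hκ]
  rw [hn]
  gcongr
  exact (norm_sub_le _ _).trans (add_le_add b1 b2)

theorem hasDerivAt_alpha (hκ : 0 < κ) (hS : S.Small κ) (t : ℝ) :
    HasDerivAt (fun s => alpha κ (S.T κ s)) 0 t := by
  have hκ' := neg_ne_zero.mpr hκ.ne'
  set W : ℝ → (Lp ℂ 2 μ →L[ℂ] Lp ℂ 2 μ) := fun s =>
    C.R (-κ) * M (S.qt s) * (C.R κ * M (star (S.q s))) +
      C.R (-κ) * M (S.q s) * (C.R κ * M (star (S.qt s))) with hW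
  -- W is the product-rule derivative of T; substituting the equation for q and its conjugate
  -- separates dispersion from nonlinearity.
  have hWUV : ∀ s, W s = (S.jet s).U κ + (S.jet s).V κ := by
    intro s
    simp only [hW]
    rw [S.star_qt_eq, S.qt_eq, Jet.U, Jet.V, mulOp_sub, mulOp_sub, mulOp_smul, ← neg_smul,
      mulOp_smul]
    simp only [jet, mul_sub, sub_mul, mul_smul_comm, smul_mul_assoc, smul_sub]
    module
  have hderiv : ∀ l s, HasDerivAt (fun r => detTerm κ (S.T κ r) (l + 1))
      (Complex.I * ((-Complex.I * κ) ^ (l + 1) * trace (S.T κ s ^ l * W s))) s := by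
    intro l s
    have hA := hasDerivAt_hsOp (C := C) hκ' (fun r => (S.hq r).memLp) (S.memLp_qt s) (S.hasDerivAt s)
    have hB := hasDerivAt_hsOp (C := C) hκ.ne' (fun r => memLp_star μ (S.hq r).memLp)
      (memLp_star μ (S.memLp_qt s)) (hasDerivAt_star _ _ (S.hasDerivAt s))
    have h := (hasDerivAt_trace_pow hA hB l).const_mul
      (Complex.I / (l + 1) * (-Complex.I * κ) ^ (l + 1))
    have h0 : (l + 1 : ℂ) ≠ 0 := by exact_mod_cast l.succ_ne_zero
    refine (h.congr_deriv ?_).congr_of_eventuallyEq (Eventually.of_forall fun r => ?_)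
    · change Complex.I / (l + 1) * (-Complex.I * κ) ^ (l + 1) *
        ((l + 1) * trace (S.T κ s ^ l * W s)) = _
      field_simp
    · simp only [detTerm_eq, ← mul_assoc]
      rfl
  -- Termwise differentiation needs one summable majorant near t, hence a local bound for ∂ₜq in L².
  obtain ⟨K, hK⟩ : ∃ K, ∀ᶠ s in 𝓝 t, ‖(S.memLp_qt s).toLp‖ < K :=
    ⟨_, S.continuous_qt.norm.continuousAt.eventually_lt continuousAt_const (lt_add_one _)⟩
  obtain ⟨ε, hε, hball⟩ := Metric.eventually_nhds_iff_ball.mp hK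
  set B := κ * (|C.hsConst (-κ)| * K * (C.hsConst κ * ‖S.u 0‖)) +
    κ * (C.hsConst (-κ) * ‖S.u 0‖ * (|C.hsConst κ| * K)) with hB
  have hbound : ∀ l, ∀ s ∈ Metric.ball t ε,
      ‖Complex.I * ((-Complex.I * κ) ^ (l + 1) * trace (S.T κ s ^ l * W s))‖ ≤
        B * (1 / 2) ^ l := by
    intro l s hs
    have m1 := C.hs_left hκ' (S.hq s).memLp
    have m2 := C.hs_left hκ.ne' (memLp_star μ (S.hq s).memLp)
    have m3 := C.hs_left hκ' (S.memLp_qt s)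
    have m4 := C.hs_left hκ.ne' (memLp_star μ (S.memLp_qt s))
    obtain ⟨n1, n2⟩ := S.hs_bounds hκ.ne' s
    have n3 : hsNorm (C.R (-κ) * M (S.qt s)) ≤ |C.hsConst (-κ)| * K :=
      (C.hs hκ' (S.memLp_qt s)).2.trans
        (mul_le_mul (le_abs_self _) (hball s hs).le (norm_nonneg _) (abs_nonneg _))
    have n4 : hsNorm (C.R κ * M (star (S.qt s))) ≤ |C.hsConst κ| * K := by
      refine (C.hs hκ.ne' (memLp_star μ (S.memLp_qt s))).2.trans ?_
      rw [S.norm_star_qt]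
      exact mul_le_mul (le_abs_self _) (hball s hs).le (norm_nonneg _) (abs_nonneg _)
    rw [norm_mul, Complex.norm_I, one_mul, mul_add,
      trace_add (TC_mul_left _ (mul_mem_TC m3 m2)) (TC_mul_left _ (mul_mem_TC m1 m4)), mul_add,
      hB, add_mul]
    refine (norm_add_le _ _).trans (add_le_add
      ((S.norm_pow_mul_trace_le hκ hS s l m3 m2).trans ?_)
      ((S.norm_pow_mul_trace_le hκ hS s l m1 m4).trans ?_))
    · exact mul_le_mul_of_nonneg_right (mul_le_mul_of_nonneg_left
        (mul_le_mul n3 n2 (hsNorm_nonneg _) ((hsNorm_nonneg _).trans n3)) hκ.le) (by positivity)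
    · exact mul_le_mul_of_nonneg_right (mul_le_mul_of_nonneg_left
        (mul_le_mul n1 n4 (hsNorm_nonneg _) ((hsNorm_nonneg _).trans n1)) hκ.le) (by positivity)
  have hsum := (summable_geometric_of_lt_one (r := (1 / 2 : ℝ)) (by norm_num)
    (by norm_num)).mul_left B
  have htsum := hasDerivAt_tsum_of_isPreconnected hsum Metric.isOpen_ball
    (convex_ball t ε).isPreconnected (fun l s _ => hderiv l s) hbound (Metric.mem_ball_self hε)
    (S.summable_detTerm hκ hS t) (Metric.mem_ball_self hε)
  -- The partial sums telescope to -i times the flux, because the flux at 0 is zero.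
  have hzero : ∑' l, Complex.I * ((-Complex.I * κ) ^ (l + 1) * trace (S.T κ t ^ l * W t)) = 0 := by
    have hs := (Summable.of_norm_bounded hsum fun l =>
      hbound l t (Metric.mem_ball_self hε)).hasSum.tendsto_sum_nat
    refine tendsto_nhds_unique hs ?_
    have he : ∀ n, ∑ l ∈ Finset.range n,
        Complex.I * ((-Complex.I * κ) ^ (l + 1) * trace (S.T κ t ^ l * W t)) =
          -(Complex.I * (S.jet t).flux κ n) := by
      intro n
      simp only [hWUV, T, Jet.trace_pow_mul_eq_flux _ hκ.ne']
      rw [← Finset.mul_sum, Finset.sum_range_sub']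
      simp [Jet.flux]
    simp only [he]
    simpa using ((S.tendsto_flux hκ hS t).const_mul Complex.I).neg
  rw [hzero] at htsum
  exact (Complex.reCLM.hasFDerivAt.comp_hasDerivAt t htsum).congr_deriv (by simp)

end Solution

end ResolventCalculus

end DNLS

end

noncomputable section

namespace DNLS

/-! ### A criterion for Hilbert-Schmidt operators -/

/-- Summing the bound for ‖A u‖² over the basis and applying Bessel to each v y gives K² ∫ ρ. In the
applications y is a frequency, ρ the squared symbol, and v y an exponential times the conjugate
coefficient. -/
theorem mem_HS_of_lintegral {H : Type*} [NormedAddCommGroup H] [InnerProductSpace ℂ H]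
    [CompleteSpace H] {Y : Type*} [MeasurableSpace Y] {ν : Measure Y} {A : H →L[ℂ] H}
    {ρ : Y → ℝ≥0∞} {v : Y → H} {C K : ℝ} (hC : 0 ≤ C) (hK : 0 ≤ K) (hv : ∀ y, ‖v y‖ ≤ K)
    (hρ : AEMeasurable ρ ν) (hvm : ∀ u, AEMeasurable (fun y => inner ℂ (v y) u) ν)
    (hA : ∀ u, ENNReal.ofReal (‖A u‖ ^ 2) ≤
      ∫⁻ y, ρ y * ENNReal.ofReal (‖inner ℂ (v y) u‖ ^ 2) ∂ν)
    (hint : ∫⁻ y, ρ y ∂ν ≤ ENNReal.ofReal (C ^ 2)) :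
    A ∈ HS H ∧ hsNorm A ≤ C * K := by
  refine mem_HS_of_sum_le (by positivity) fun s => ?_
  rw [← ENNReal.ofReal_le_ofReal_iff (by positivity), ENNReal.ofReal_sum_of_nonneg
    fun _ _ => by positivity]
  calc ∑ i ∈ s, ENNReal.ofReal (‖A (stdBasis H i)‖ ^ 2)
      ≤ ∑ i ∈ s, ∫⁻ y, ρ y * ENNReal.ofReal (‖inner ℂ (v y) (stdBasis H i)‖ ^ 2) ∂ν :=
        Finset.sum_le_sum fun i _ => hA _
    _ = ∫⁻ y, ∑ i ∈ s, ρ y * ENNReal.ofReal (‖inner ℂ (v y) (stdBasis H i)‖ ^ 2) ∂ν := by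
        rw [lintegral_finsetSum']
        exact fun i _ => hρ.mul ((hvm _).norm.pow_const 2).ennreal_ofReal
    _ ≤ ∫⁻ y, ρ y * ENNReal.ofReal (K ^ 2) ∂ν := by
        refine lintegral_mono fun y => ?_
        rw [← Finset.mul_sum, ← ENNReal.ofReal_sum_of_nonneg fun _ _ => by positivity]
        gcongr
        calc ∑ i ∈ s, ‖inner ℂ (v y) (stdBasis H i)‖ ^ 2
            = ∑ i ∈ s, ‖inner ℂ (stdBasis H i) (v y)‖ ^ 2 := by simp_rw [norm_inner_symm (v y)]
          _ ≤ ‖v y‖ ^ 2 := (stdBasis H).orthonormal.sum_inner_products_le _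
          _ ≤ K ^ 2 := pow_le_pow_left₀ (norm_nonneg _) (hv y) 2
    _ = (∫⁻ y, ρ y ∂ν) * ENNReal.ofReal (K ^ 2) := lintegral_mul_const'' _ hρ
    _ ≤ ENNReal.ofReal (C ^ 2) * ENNReal.ofReal (K ^ 2) := by gcongr
    _ = _ := by rw [← ENNReal.ofReal_mul (by positivity), mul_pow]

/-! ### The Fourier transform on `L¹ ∩ L²` -/

open FourierTransform

/-- The Hilbert space `L²(ℝ)`. -/
abbrev L2Line : Type := Lp ℂ 2 (volume : Measure ℝ)

/-- Both functions have the same integrals against test functions: the L² transform agrees with the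
distributional one, and the L¹ transform satisfies ∫ ψ̂ g = ∫ ψ ĝ. -/
theorem coeFn_fourierTransform {g : ℝ → ℂ} (h1 : Integrable g) (h2 : MemLp g 2 volume) :
    (Lp.fourierTransformₗᵢ ℝ ℂ h2.toLp : ℝ → ℂ) =ᵐ[volume] 𝓕 g := by
  have hc : Continuous (𝓕 g) := VectorFourier.fourierIntegral_continuous
    Real.continuous_fourierChar continuous_inner h1
  refine ae_eq_of_integral_contDiff_smul_eq
    ((Lp.memLp _).locallyIntegrable (by norm_num)) hc.locallyIntegrable fun φ hφ hφc => ?_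
  set ψ : 𝓢(ℝ, ℂ) := HasCompactSupport.toSchwartzMap (f := fun x => (φ x : ℂ))
    (hφc.comp_left (g := ((↑) : ℝ → ℂ)) rfl) (Complex.ofRealCLM.contDiff.comp hφ) with hψ
  have e : ∀ k : ℝ → ℂ, ∫ x, φ x • k x = ∫ x, ψ x • k x := fun k => by
    refine integral_congr_ae (Eventually.of_forall fun x => ?_)
    exact (Complex.coe_smul (φ x) (k x)).symm
  rw [e, e]
  have h := Lp.fourier_toTemperedDistribution_eq (h2.toLp)
  have h' := congrArg (fun d => d ψ) h
  rw [TemperedDistribution.fourier_apply, Lp.toTemperedDistribution_apply,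
    Lp.toTemperedDistribution_apply] at h'
  rw [show Lp.fourierTransformₗᵢ ℝ ℂ h2.toLp = 𝓕 h2.toLp from rfl, ← h']
  have hflip := VectorFourier.integral_fourierIntegral_smul_eq_flip (L := innerₗ ℝ) (f := ψ) (g := g)
    Real.continuous_fourierChar continuous_inner (ψ.integrable (μ := volume)) h1
  rw [flip_innerₗ] at hflip
  refine (integral_congr_ae ?_).trans hflip
  filter_upwards [h2.coeFn_toLp] with x hx
  rw [hx]
  rfl

/-! ### Resolvents on the line -/

theorem lineSymbol_apply (a : ℝ) (ha : a ≠ 0) (ξ : ℝ) :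
    lineSymbol a ha ξ = ((a : ℂ) + ((2 * π * ξ : ℝ) : ℂ) * Complex.I)⁻¹ := rfl

theorem fourierTransform_lineResolvent (a : ℝ) (ha : a ≠ 0) (u : L2Line) :
    Lp.fourierTransformₗᵢ ℝ ℂ (lineResolvent a ha u) =
      mulOp volume (lineSymbol a ha) (Lp.fourierTransformₗᵢ ℝ ℂ u) :=
  (Lp.fourierTransformₗᵢ ℝ ℂ).apply_symm_apply _

theorem norm_lineResolvent_apply (a : ℝ) (ha : a ≠ 0) (u : L2Line) :
    ‖lineResolvent a ha u‖ = ‖mulOp volume (lineSymbol a ha) (Lp.fourierTransformₗᵢ ℝ ℂ u)‖ := by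
  rw [← fourierTransform_lineResolvent, LinearIsometryEquiv.norm_map]

theorem norm_lineResolvent_le (a : ℝ) (ha : a ≠ 0) : ‖lineResolvent a ha‖ ≤ |a|⁻¹ := by
  refine ContinuousLinearMap.opNorm_le_bound _ (by positivity) fun u => ?_
  rw [norm_lineResolvent_apply, ← (Lp.fourierTransformₗᵢ ℝ ℂ).norm_map u]
  refine Lp.norm_le_mul_norm_of_ae_le_mul ?_
  filter_upwards [coeFn_mulOp volume (lineSymbol a ha) (Lp.fourierTransformₗᵢ ℝ ℂ u)] with ξ h
  rw [h, norm_mul]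
  exact mul_le_mul_of_nonneg_right (norm_symbol_le a _ ha) (norm_nonneg _)

theorem lineResolvent_resolvent {a b : ℝ} (ha : a ≠ 0) (hb : b ≠ 0) :
    lineResolvent b hb = lineResolvent a ha +
      ((a - b : ℝ) : ℂ) • (lineResolvent a ha * lineResolvent b hb) := by
  ext1 u
  apply (Lp.fourierTransformₗᵢ ℝ ℂ).injective
  have hs : lineSymbol b hb = lineSymbol a ha +
      ((a - b : ℝ) : ℂ) • (lineSymbol a ha * lineSymbol b hb) := by
    ext ξ
    have h1 := symbol_ne_zero a (2 * π * ξ) ha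
    have h2 := symbol_ne_zero b (2 * π * ξ) hb
    simp only [BoundedContinuousFunction.add_apply, BoundedContinuousFunction.smul_apply,
      BoundedContinuousFunction.mul_apply, lineSymbol_apply, smul_eq_mul]
    field_simp
    push_cast
    ring
  rw [add_apply, smul_apply, mul_apply_eq_comp, map_add, map_smul, fourierTransform_lineResolvent,
    fourierTransform_lineResolvent, fourierTransform_lineResolvent, fourierTransform_lineResolvent]
  conv_lhs => rw [hs, mulOp_add, mulOp_smul, mulOp_mul]
  rfl

/-- The Fourier transform of g' + a g is (a + 2πiξ) ĝ, so the multiplier really inverts ∂ + a. -/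
theorem lineResolvent_apply_of_hasDerivAt {a : ℝ} (ha : a ≠ 0) {g g' : ℝ → ℂ}
    (hd : ∀ x, HasDerivAt g (g' x) x) (hg : Integrable g) (hg' : Integrable g')
    (hg2 : MemLp g 2 volume) (hg2' : MemLp g' 2 volume) :
    lineResolvent a ha (hg2'.toLp + (a : ℂ) • hg2.toLp) = hg2.toLp := by
  apply (Lp.fourierTransformₗᵢ ℝ ℂ).injective
  rw [fourierTransform_lineResolvent]
  apply Lp.ext
  have hderiv : deriv g = g' := funext fun x => (hd x).deriv
  have hF := Real.fourier_deriv hg (fun x => (hd x).differentiableAt) (by rwa [hderiv])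
  rw [hderiv] at hF
  filter_upwards [coeFn_mulOp volume (lineSymbol a ha)
    (Lp.fourierTransformₗᵢ ℝ ℂ (hg2'.toLp + (a : ℂ) • hg2.toLp)),
    coeFn_fourierTransform hg hg2, coeFn_fourierTransform (hg'.add (hg.const_mul (a : ℂ)))
      (hg2'.add (hg2.const_mul (a : ℂ))), coeFn_fourierTransform hg' hg2',
      Lp.coeFn_add (Lp.fourierTransformₗᵢ ℝ ℂ hg2'.toLp)
        ((a : ℂ) • Lp.fourierTransformₗᵢ ℝ ℂ hg2.toLp),
      Lp.coeFn_smul (a : ℂ) (Lp.fourierTransformₗᵢ ℝ ℂ hg2.toLp)] with ξ h1 h2 h3 h4 h5 h6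
  rw [h1, map_add, map_smul, h5, Pi.add_apply, h6, Pi.smul_apply, h2, h4, hF, lineSymbol_apply]
  have h := symbol_ne_zero a (2 * π * ξ) ha
  rw [inv_mul_eq_iff_eq_mul₀ h]
  simp only [smul_eq_mul]
  push_cast
  ring

/-- Rationalize: 1/(b + iy) = b⁻² (b - iy) (1 + (y/b)²)⁻¹ with y = 2πξ. -/
theorem hasTemperateGrowth_inv_symbol {b : ℝ} (hb : b ≠ 0) :
    Function.HasTemperateGrowth fun ξ : ℝ => ((b : ℂ) + ((2 * π * ξ : ℝ) : ℂ) * Complex.I)⁻¹ := by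
  have h1 : Function.HasTemperateGrowth fun ξ : ℝ => (1 + ‖(2 * π / b) * ξ‖ ^ 2) ^ (-1 : ℝ) :=
    (Function.hasTemperateGrowth_one_add_norm_sq_rpow ℝ (-1)).comp
      (((2 * π / b) • ContinuousLinearMap.id ℝ ℝ).hasTemperateGrowth)
  have h2 : Function.HasTemperateGrowth
      fun ξ : ℝ => (b ^ 2 : ℂ)⁻¹ * (b - ((2 * π * ξ : ℝ) : ℂ) * Complex.I) := by
    have : Function.HasTemperateGrowth fun ξ : ℝ => (ξ : ℂ) :=
      Complex.ofRealCLM.hasTemperateGrowth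
    push_cast
    fun_prop
  have h3 := h2.mul (Function.HasTemperateGrowth.comp Complex.ofRealCLM.hasTemperateGrowth h1)
  convert! h3 using 1
  ext ξ
  have h4 := symbol_ne_zero b (2 * π * ξ) hb
  have hb' : (b : ℂ) ≠ 0 := by exact_mod_cast hb
  have h5 : (1 + ‖(2 * π / b) * ξ‖ ^ 2) ^ (-1 : ℝ) = b ^ 2 / (b ^ 2 + (2 * π * ξ) ^ 2) := by
    rw [Real.rpow_neg_one, Real.norm_eq_abs, sq_abs]
    field_simp
  have h6 : ((b ^ 2 + (2 * π * ξ) ^ 2 : ℝ) : ℂ) ≠ 0 := by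
    have : 0 < b ^ 2 + (2 * π * ξ) ^ 2 := by positivity
    exact_mod_cast this.ne'
  change _ = (b ^ 2 : ℂ)⁻¹ * (b - ((2 * π * ξ : ℝ) : ℂ) * Complex.I) *
    (((1 + ‖(2 * π / b) * ξ‖ ^ 2) ^ (-1 : ℝ) : ℝ) : ℂ)
  rw [h5]
  refine inv_eq_of_mul_eq_one_right ?_
  have h7 : ((b ^ 2 + (2 * π * ξ) ^ 2 : ℝ) : ℂ) = ((b : ℂ) + ((2 * π * ξ : ℝ) : ℂ) * Complex.I) *
      (b - ((2 * π * ξ : ℝ) : ℂ) * Complex.I) := by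
    push_cast
    linear_combination (2 * π * ξ : ℂ) ^ 2 * Complex.I_sq
  rw [Complex.ofReal_div, ← mul_assoc, ← mul_assoc, mul_comm _ (b ^ 2 : ℂ)⁻¹, mul_assoc (b ^ 2 : ℂ)⁻¹,
    ← h7, Complex.ofReal_pow]
  generalize ((b ^ 2 + (2 * π * ξ) ^ 2 : ℝ) : ℂ) = D at h6
  field_simp

/-- Every Schwartz v is (∂ + b)u with u Schwartz, so operator identities involving R b can be tested
where R b v = u is a genuine function. -/
theorem exists_schwartz_deriv_add {b : ℝ} (hb : b ≠ 0) (v : 𝓢(ℝ, ℂ)) :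
    ∃ u : 𝓢(ℝ, ℂ), ∀ x, deriv u x + b * u x = v x := by
  set m := fun ξ : ℝ => ((b : ℂ) + ((2 * π * ξ : ℝ) : ℂ) * Complex.I)⁻¹
  have hm : Function.HasTemperateGrowth m := hasTemperateGrowth_inv_symbol hb
  set u : 𝓢(ℝ, ℂ) := 𝓕⁻ (SchwartzMap.smulLeftCLM ℂ m (𝓕 v)) with hu
  refine ⟨u, ?_⟩
  have h : SchwartzMap.derivCLM ℂ ℂ u + (b : ℂ) • u = v := by
    apply (FourierTransform.fourierEquiv ℂ 𝓢(ℝ, ℂ)).injective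
    ext ξ
    have e1 : 𝓕 u = SchwartzMap.smulLeftCLM ℂ m (𝓕 v) := FourierTransform.fourier_fourierInv_eq _
    have e2 : 𝓕 (u : ℝ → ℂ) ξ = m ξ * 𝓕 (v : ℝ → ℂ) ξ := by
      have := congrArg (fun k : 𝓢(ℝ, ℂ) => k ξ) e1
      simpa [SchwartzMap.smulLeftCLM_apply_apply hm, SchwartzMap.fourier_coe] using this
    have e3 := congrFun (Real.fourier_deriv u.integrable u.differentiable
      (SchwartzMap.derivCLM ℂ ℂ u).integrable) ξ
    have e4 : 𝓕 (SchwartzMap.derivCLM ℂ ℂ u : ℝ → ℂ) ξ = (2 * π * Complex.I * ξ) • 𝓕 (u : ℝ → ℂ) ξ := e3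
    have h4 := symbol_ne_zero b (2 * π * ξ) hb
    rw [map_add, map_smul]
    change 𝓕 (SchwartzMap.derivCLM ℂ ℂ u) ξ + (b : ℂ) • (𝓕 u) ξ = (𝓕 v) ξ
    rw [SchwartzMap.fourier_coe, SchwartzMap.fourier_coe, SchwartzMap.fourier_coe, e4, e2]
    have h5 : ((b : ℂ) + ((2 * π * ξ : ℝ) : ℂ) * Complex.I) * m ξ = 1 := mul_inv_cancel₀ h4
    push_cast at h5
    simp only [smul_eq_mul]
    linear_combination 𝓕 (v : ℝ → ℂ) ξ * h5
  intro x
  exact congrArg (fun k : 𝓢(ℝ, ℂ) => k x) h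

end DNLS

end

noncomputable section

namespace DNLS

open FourierTransform

/-! ### Representatives of products and norms in L² -/

section L2

variable {X : Type*} [TopologicalSpace X] [MeasurableSpace X] [BorelSpace X] {μ : Measure X}

theorem mulOp_toLp (m : X →ᵇ ℂ) {k : X → ℂ} (hk : MemLp k 2 μ)
    (hmk : MemLp (fun x => m x * k x) 2 μ) : mulOp μ m hk.toLp = hmk.toLp := by
  apply Lp.ext
  filter_upwards [coeFn_mulOp μ m hk.toLp, hk.coeFn_toLp, hmk.coeFn_toLp] with x h1 h2 h3
  rw [h1, h2, h3]

theorem memLp_mul_fun (m : X →ᵇ ℂ) {k : X → ℂ} (hk : MemLp k 2 μ) :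
    MemLp (fun x => m x * k x) 2 μ :=
  hk.mul (r := 2) (memLp_top_of_bound (μ := μ) m.continuous.aestronglyMeasurable ‖m‖
    (Eventually.of_forall m.norm_coe_le_norm))

omit [TopologicalSpace X] [BorelSpace X] in
theorem ofReal_norm_sq_eq_lintegral (g : Lp ℂ 2 μ) :
    ENNReal.ofReal (‖g‖ ^ 2) = ∫⁻ x, ENNReal.ofReal (‖g x‖ ^ 2) ∂μ := by
  have h1 : ‖g‖ ^ 2 = ∫ x, ‖g x‖ ^ 2 ∂μ := by
    have h := inner_self_eq_norm_sq_to_K (𝕜 := ℂ) g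
    rw [L2.inner_def] at h
    have h2 : ∀ x, inner ℂ (g x) (g x) = ((‖g x‖ ^ 2 : ℝ) : ℂ) := fun x => by
      rw [inner_self_eq_norm_sq_to_K]
      simp
    simp_rw [h2] at h
    rw [integral_complex_ofReal] at h
    apply Complex.ofReal_injective
    rw [h]
    push_cast
    rfl
  rw [h1, ofReal_integral_eq_lintegral_ofReal]
  · exact (memLp_two_iff_integrable_sq_norm (Lp.aestronglyMeasurable g)).1 (Lp.memLp g)
  · exact Eventually.of_forall fun x => by positivity

end L2

/-! ### The resolvent calculus on the line -/

/-- The weight `1 / (1 + x²)`. -/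
def lineWeight : ℝ →ᵇ ℂ :=
  BoundedContinuousFunction.ofNormedAddCommGroup (fun x : ℝ => (((1 + x ^ 2)⁻¹ : ℝ) : ℂ))
    (Complex.continuous_ofReal.comp (Continuous.inv₀ (by fun_prop) fun x => by positivity)) 1
    fun x => by
      rw [Complex.norm_real, Real.norm_of_nonneg (by positivity)]
      exact inv_le_one_of_one_le₀ (by nlinarith)

theorem abs_weight_deriv_le (x : ℝ) : |-(2 * x) / (1 + x ^ 2) ^ 2| ≤ (1 + x ^ 2)⁻¹ := by
  have h : 0 < 1 + x ^ 2 := by positivity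
  rw [abs_div, abs_of_pos (pow_pos h 2), div_le_iff₀ (pow_pos h 2), pow_two (1 + x ^ 2),
    inv_mul_cancel_left₀ h.ne', abs_le]
  constructor <;> nlinarith [sq_nonneg (x - 1), sq_nonneg (x + 1)]

theorem inv_one_add_sq_le_one (x : ℝ) : (1 + x ^ 2)⁻¹ ≤ 1 :=
  inv_le_one_of_one_le₀ (by nlinarith)

/-- The derivative of `lineWeight`. -/
def lineWeight' : ℝ →ᵇ ℂ :=
  BoundedContinuousFunction.ofNormedAddCommGroup
    (fun x : ℝ => ((-(2 * x) / (1 + x ^ 2) ^ 2 : ℝ) : ℂ))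
    (Complex.continuous_ofReal.comp (Continuous.div (by fun_prop) (by fun_prop)
      fun x => by positivity)) 1
    fun x => by
      rw [Complex.norm_real]
      exact (abs_weight_deriv_le x).trans (inv_one_add_sq_le_one x)

theorem memLp_of_norm_le_weight {f : ℝ → ℂ} (hf : Continuous f)
    (h : ∀ x, ‖f x‖ ≤ (1 + x ^ 2)⁻¹) : MemLp f 2 volume := by
  rw [memLp_two_iff_integrable_sq_norm hf.aestronglyMeasurable]
  refine integrable_inv_one_add_sq.mono' (by fun_prop) (Eventually.of_forall fun x => ?_)
  rw [Real.norm_of_nonneg (by positivity), pow_two]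
  have h0 : (0 : ℝ) ≤ (1 + x ^ 2)⁻¹ := by positivity
  exact (mul_le_mul (h x) ((h x).trans (inv_one_add_sq_le_one x)) (norm_nonneg _) h0).trans
    (mul_one _).le

theorem hasDerivAt_lineWeight (x : ℝ) : HasDerivAt lineWeight (lineWeight' x) x := by
  have h : (1 + x ^ 2 : ℝ) ≠ 0 := by positivity
  have h1 : HasDerivAt (fun y : ℝ => 1 + y ^ 2) (2 * x) x := by
    simpa using (hasDerivAt_pow 2 x).const_add 1
  exact (h1.inv h).ofReal_comp

/-- On the dense set of v = u' + b u the identity is the product rule: R a applied to (f u)' + a f u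
gives f u. -/
theorem lineResolvent_mul_mulOp_mul {f f' : ℝ →ᵇ ℂ} (hf : ∀ x, HasDerivAt f (f' x) x) {a b : ℝ}
    (ha : a ≠ 0) (hb : b ≠ 0) :
    lineResolvent a ha * mulOp volume f' * lineResolvent b hb =
      mulOp volume f * lineResolvent b hb - lineResolvent a ha * mulOp volume f +
        ((b - a : ℝ) : ℂ) • (lineResolvent a ha * mulOp volume f * lineResolvent b hb) := by
  apply ContinuousLinearMap.coeFn_injective
  refine (SchwartzMap.denseRange_toLpCLM (E := ℝ) (F := ℂ) (p := 2)
    (μ := (volume : Measure ℝ)) (by norm_num)).equalizer (ContinuousLinearMap.continuous _)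
    (ContinuousLinearMap.continuous _) (funext fun v => ?_)
  obtain ⟨u, hu⟩ := exists_schwartz_deriv_add hb v
  set u' : 𝓢(ℝ, ℂ) := SchwartzMap.derivCLM ℂ ℂ u
  have hud : ∀ x, HasDerivAt u (u' x) x := fun x => (u.differentiable x).hasDerivAt
  have m0 : MemLp u 2 volume := u.memLp 2
  have m1 : MemLp u' 2 volume := u'.memLp 2
  have m2 : MemLp v 2 volume := v.memLp 2
  have hv : m2.toLp = m1.toLp + (b : ℂ) • m0.toLp := by
    apply Lp.ext
    filter_upwards [m2.coeFn_toLp, m1.coeFn_toLp, m0.coeFn_toLp, Lp.coeFn_add m1.toLp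
      ((b : ℂ) • m0.toLp), Lp.coeFn_smul (b : ℂ) m0.toLp] with x h1 h2 h3 h4 h5
    rw [h1, h4, Pi.add_apply, h5, Pi.smul_apply, h2, h3]
    exact (hu x).symm
  have hR : lineResolvent b hb m2.toLp = m0.toLp := by
    rw [hv]
    exact lineResolvent_apply_of_hasDerivAt hb hud u.integrable u'.integrable m0 m1
  have n0 := memLp_mul_fun f m0
  have n1 := memLp_mul_fun f' m0
  have n2 := memLp_mul_fun f m1
  have i0 : Integrable (fun x => f x * u x) := u.integrable.bdd_mul
    f.continuous.aestronglyMeasurable (Eventually.of_forall f.norm_coe_le_norm)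
  have i1 : Integrable (fun x => f' x * u x) := u.integrable.bdd_mul
    f'.continuous.aestronglyMeasurable (Eventually.of_forall f'.norm_coe_le_norm)
  have i2 : Integrable (fun x => f x * u' x) := u'.integrable.bdd_mul
    f.continuous.aestronglyMeasurable (Eventually.of_forall f.norm_coe_le_norm)
  have key := lineResolvent_apply_of_hasDerivAt ha (fun x => (hf x).mul (hud x)) i0 (i1.add i2)
    n0 (n1.add n2)
  have key' : lineResolvent a ha (mulOp volume f' m0.toLp + mulOp volume f m1.toLp +
      (a : ℂ) • mulOp volume f m0.toLp) = mulOp volume f m0.toLp := by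
    rw [mulOp_toLp f' m0 n1, mulOp_toLp f m1 n2, mulOp_toLp f m0 n0]
    exact key
  change (lineResolvent a ha * mulOp volume f' * lineResolvent b hb) m2.toLp = (_ : _ →L[ℂ] _)
    m2.toLp
  simp only [add_apply, sub_apply, smul_apply, mul_apply_eq_comp, hR]
  rw [hv]
  simp only [map_add, map_smul] at key' ⊢
  push_cast
  refine sub_eq_zero.1 ((?_ : _ = _ - _).trans (sub_eq_zero.2 key'))
  module

/-- At frequency ξ the transform of R a f u is the symbol times ⟨v_ξ, u⟩ with v_ξ = e^{2πixξ} f̄ of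
norm ‖f‖. The constant comes from ∫ dξ/(a² + 4π²ξ²) = 1/(2|a|). -/
theorem lineResolvent_hs {a : ℝ} (ha : a ≠ 0) {f : ℝ →ᵇ ℂ} (hf : MemLp f 2 volume) :
    lineResolvent a ha * mulOp volume f ∈ HS L2Line ∧
      hsNorm (lineResolvent a ha * mulOp volume f) ≤ √(1 / (2 * |a|)) * ‖hf.toLp‖ := by
  have hc : ∀ ξ : ℝ, Continuous fun x : ℝ => (Real.fourierChar (x * ξ) : ℂ) := fun ξ =>
    continuous_subtype_val.comp (Real.continuous_fourierChar.comp (by fun_prop))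
  have hv : ∀ ξ : ℝ, MemLp (fun x => (Real.fourierChar (x * ξ) : ℂ) * star (f x)) 2 volume :=
    fun ξ => (hf.star).of_le ((hc ξ).aestronglyMeasurable.mul
      f.continuous.star.aestronglyMeasurable) (Eventually.of_forall fun x => by
        rw [norm_mul, Circle.norm_coe, one_mul, Pi.star_apply])
  have hinner : ∀ (u : L2Line) (ξ : ℝ), inner ℂ (hv ξ).toLp u = 𝓕 (fun x => f x * u x) ξ := by
    intro u ξ
    rw [L2.inner_def, Real.fourier_eq']
    refine integral_congr_ae ?_
    filter_upwards [(hv ξ).coeFn_toLp] with x h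
    rw [h]
    have e : (starRingEnd ℂ) (Complex.exp (2 * π * (x * ξ) * Complex.I)) =
        Complex.exp (-(2 * π * (ξ * x) * Complex.I)) := by
      rw [← Complex.exp_conj]
      simp [mul_comm (x : ℂ), map_ofNat (starRingEnd ℂ) 2]
    simp [Real.fourierChar_apply, e]
    ring
  have hi : ∀ u : L2Line, Integrable fun x => f x * u x := fun u =>
    hf.integrable_mul (Lp.memLp u)
  have hm : ∀ u : L2Line, mulOp volume f u = (memLp_mul_fun f (Lp.memLp u)).toLp := fun u => by
    rw [← mulOp_toLp f (Lp.memLp u), Lp.toLp_coeFn]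
  refine mem_HS_of_lintegral (ν := volume)
    (ρ := fun ξ => ENNReal.ofReal (‖lineSymbol a ha ξ‖ ^ 2)) (v := fun ξ => (hv ξ).toLp)
    (Real.sqrt_nonneg _) (norm_nonneg _) (fun ξ => ?_) ?_ (fun u => ?_) (fun u => ?_) ?_
  · exact Lp.norm_le_norm_of_ae_le (by
      filter_upwards [(hv ξ).coeFn_toLp, hf.coeFn_toLp] with x h1 h2
      rw [h1, h2, norm_mul, Circle.norm_coe, one_mul, norm_star])
  · exact (ENNReal.continuous_ofReal.comp (by fun_prop)).measurable.aemeasurable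
  · simp_rw [hinner]
    exact (VectorFourier.fourierIntegral_continuous Real.continuous_fourierChar continuous_inner
      (hi u)).measurable.aemeasurable
  · rw [mul_apply_eq_comp, norm_lineResolvent_apply, ofReal_norm_sq_eq_lintegral]
    refine (lintegral_congr_ae ?_).le
    filter_upwards [coeFn_mulOp volume (lineSymbol a ha)
      (Lp.fourierTransformₗᵢ ℝ ℂ (mulOp volume f u)),
      coeFn_fourierTransform (hi u) (memLp_mul_fun f (Lp.memLp u))] with ξ h1 h2
    rw [h1, hm, h2, hinner, norm_mul, mul_pow, ENNReal.ofReal_mul (by positivity)]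
  · have hint : ∀ ξ : ℝ, ‖lineSymbol a ha ξ‖ ^ 2 =
        (a ^ 2)⁻¹ * (1 + ((2 * π / a) * ξ) ^ 2)⁻¹ := fun ξ => by
      rw [lineSymbol_apply, norm_inv, inv_pow, ← mul_inv, Complex.sq_norm, Complex.normSq_add_mul_I]
      congr 1
      field_simp
    have hI : Integrable fun ξ : ℝ => (a ^ 2)⁻¹ * (1 + ((2 * π / a) * ξ) ^ 2)⁻¹ :=
      (integrable_inv_one_add_sq.comp_mul_left' (by positivity)).const_mul _
    simp_rw [hint]
    rw [← ofReal_integral_eq_lintegral_ofReal hI (Eventually.of_forall fun x => by positivity),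
      integral_const_mul, Measure.integral_comp_mul_left (fun y : ℝ => (1 + y ^ 2)⁻¹),
      integral_univ_inv_one_add_sq, Real.sq_sqrt (by positivity)]
    refine (congrArg ENNReal.ofReal ?_).le
    rw [abs_inv, abs_div, abs_of_pos Real.two_pi_pos, ← sq_abs a, smul_eq_mul]
    have := abs_pos.2 ha
    field_simp

/-- Multiplication, differentiation and the resolvents on the line. -/
def lineCalculus : ResolventCalculus (volume : Measure ℝ) where
  -- The value at a = 0 is arbitrary: every law assumes nonzero parameters.
  R a := if h : a ≠ 0 then lineResolvent a h else 0
  Der f f' := ∀ x, HasDerivAt f (f' x) x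
  hsConst a := √(1 / (2 * |a|))
  w := lineWeight
  w' := lineWeight'
  der_mul hf hg x := (hf x).mul (hg x)
  der_add hf hg x := (hf x).add (hg x)
  der_star hf x := (hf x).star
  integral_der hf h h' := integral_eq_zero_of_hasDerivAt_of_integrable hf h' h
  der_comm hf a b ha hb := by
    simp only [dif_pos ha, dif_pos hb]
    exact lineResolvent_mul_mulOp_mul hf ha hb
  resolvent ha hb := by
    simp only [dif_pos ha, dif_pos hb]
    exact lineResolvent_resolvent ha hb
  norm_le ha := by
    simp only [dif_pos ha]
    exact norm_lineResolvent_le _ ha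
  hs ha f hf := by
    simp only [dif_pos ha]
    exact lineResolvent_hs ha hf
  hsConst_tendsto := by
    have h : Tendsto (fun a : ℝ => 1 / (2 * |a|)) atTop (𝓝 0) :=
      tendsto_const_nhds.div_atTop (tendsto_abs_atTop_atTop.const_mul_atTop two_pos)
    rw [← Real.sqrt_zero]
    exact (Real.continuous_sqrt.tendsto 0).comp h
  der_w := hasDerivAt_lineWeight
  memLp_w := memLp_of_norm_le_weight lineWeight.continuous fun x => by
    change ‖(((1 + x ^ 2)⁻¹ : ℝ) : ℂ)‖ ≤ _
    rw [Complex.norm_real, Real.norm_of_nonneg (by positivity)]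
  memLp_w' := memLp_of_norm_le_weight lineWeight'.continuous fun x => by
    change ‖((-(2 * x) / (1 + x ^ 2) ^ 2 : ℝ) : ℂ)‖ ≤ _
    rw [Complex.norm_real]
    exact abs_weight_deriv_le x

end DNLS

end

noncomputable section

namespace DNLS

/-! ### Solutions on the line -/

theorem lineCalculus_R {a : ℝ} (ha : a ≠ 0) : lineCalculus.R a = lineResolvent a ha := dif_pos ha

theorem lineCalculus_reg (u : 𝓢(ℝ, ℂ)) : lineCalculus.Reg u.toBoundedContinuousFunction
    (SchwartzMap.derivCLM ℂ ℂ u).toBoundedContinuousFunction where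
  der x := (u.differentiable x).hasDerivAt
  memLp := u.memLp 2 volume
  memLp' := (SchwartzMap.derivCLM ℂ ℂ u).memLp 2 volume

theorem lineCalculus_divisible (u : 𝓢(ℝ, ℂ)) {f : ℝ →ᵇ ℂ} (hf : ∀ x, f x = u x) :
    lineCalculus.Divisible f := by
  have hg : Function.HasTemperateGrowth fun x : ℝ => (1 + (x : ℂ) ^ 2) := by
    have : Function.HasTemperateGrowth fun ξ : ℝ => (ξ : ℂ) :=
      Complex.ofRealCLM.hasTemperateGrowth
    fun_prop
  set v := SchwartzMap.smulLeftCLM ℂ (fun x : ℝ => (1 + (x : ℂ) ^ 2)) u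
  refine ⟨v.toBoundedContinuousFunction, v.memLp 2 volume, ?_⟩
  ext x
  have h : ((1 + x ^ 2 : ℝ) : ℂ) ≠ 0 := by
    have : (1 + x ^ 2 : ℝ) ≠ 0 := by positivity
    exact_mod_cast this
  have e : v x = (1 + (x : ℂ) ^ 2) * u x := SchwartzMap.smulLeftCLM_apply_apply hg u x
  change f x = v x * (((1 + x ^ 2)⁻¹ : ℝ) : ℂ)
  rw [e, hf]
  push_cast at h ⊢
  field_simp

/-- The complex conjugate of a Schwartz function. -/
def schwartzStar (u : 𝓢(ℝ, ℂ)) : 𝓢(ℝ, ℂ) :=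
  SchwartzMap.postcompCLM (Complex.conjCLE : ℂ →L[ℝ] ℂ) u

/-- The Schwartz space carries no single norm; its difference quotients are pushed through a
continuous linear map into L² or to a point value. -/
theorem hasDerivAt_of_tendsto_smul {E F : Type*} [AddCommGroup E] [Module ℝ E] [TopologicalSpace E]
    [NormedAddCommGroup F] [NormedSpace ℝ F] (L : E →L[ℝ] F) {q : ℝ → E} {q' : E} {t : ℝ}
    (h : Tendsto (fun h : ℝ => h⁻¹ • (q (t + h) - q t)) (𝓝[≠] 0) (𝓝 q')) :
    HasDerivAt (fun s => L (q s)) (L q') t := by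
  rw [hasDerivAt_iff_tendsto_slope_zero]
  refine ((L.continuous.tendsto q').comp h).congr fun r => ?_
  simp

theorem dnls_deriv {u : ℝ → ℂ} {u' : ℝ → ℂ} {u'' : ℂ} {x : ℝ} (h1 : ∀ y, HasDerivAt u (u' y) y)
    (h2 : HasDerivAt u' u'' x) {v : ℂ}
    (h : Complex.I * v + iteratedDeriv 2 u x +
      Complex.I * deriv (fun y => (‖u y‖ : ℂ) ^ 2 * u y) x = 0) :
    v = Complex.I * u'' - ((u' x * star (u x) + u x * star (u' x)) * u x +
      u x * star (u x) * u' x) := by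
  have e1 : iteratedDeriv 2 u x = u'' := by
    rw [iteratedDeriv_succ, iteratedDeriv_one, show deriv u = u' from funext fun y => (h1 y).deriv,
      h2.deriv]
  have e2 : (fun y => (‖u y‖ : ℂ) ^ 2 * u y) = fun y => u y * star (u y) * u y := by
    ext y
    rw [← Complex.mul_conj']
    rfl
  have e3 := (((h1 x).mul (h1 x).star).mul (h1 x)).deriv
  rw [e1, e2] at h
  change deriv (fun y => u y * star (u y) * u y) x = _ at e3
  rw [e3] at h
  simp only [Pi.mul_apply] at h
  linear_combination (-Complex.I) * h + (v + (u' x * star (u x) + u x * star (u' x)) * u x +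
      u x * star (u x) * u' x) * Complex.I_sq

/-- The solution on the line given by a curve in the Schwartz space. -/
def lineSolution {q : ℝ → 𝓢(ℝ, ℂ)} {Q : ℕ → ℝ → 𝓢(ℝ, ℂ)} (hQ : Q 0 = q)
    (hd : ∀ k t, Tendsto (fun h : ℝ => h⁻¹ • (Q k (t + h) - Q k t)) (𝓝[≠] 0) (𝓝 (Q (k + 1) t)))
    (hs : SolvesDNLS fun t x => q t x) : lineCalculus.Solution where
  q t := (q t).toBoundedContinuousFunction
  q₁ t := (SchwartzMap.derivCLM ℂ ℂ (q t)).toBoundedContinuousFunction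
  q₂ t := (SchwartzMap.derivCLM ℂ ℂ (SchwartzMap.derivCLM ℂ ℂ (q t))).toBoundedContinuousFunction
  hq t := lineCalculus_reg _
  hq₁ t := lineCalculus_reg _
  div_q t := lineCalculus_divisible (q t) fun _ => rfl
  div_q₁ t := lineCalculus_divisible (SchwartzMap.derivCLM ℂ ℂ (q t)) fun _ => rfl
  div_star_q₁ t := lineCalculus_divisible (schwartzStar (SchwartzMap.derivCLM ℂ ℂ (q t)))
    fun _ => rfl
  qt t := (Q 1 t).toBoundedContinuousFunction
  memLp_qt t := (Q 1 t).memLp 2 volume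
  hasDerivAt t := by
    subst hQ
    exact hasDerivAt_of_tendsto_smul (SchwartzMap.toLpCLM ℝ ℂ 2 (volume : Measure ℝ)) (hd 0 t)
  continuous_qt := continuous_iff_continuousAt.2 fun t =>
    (hasDerivAt_of_tendsto_smul (SchwartzMap.toLpCLM ℝ ℂ 2 (volume : Measure ℝ))
      (hd 1 t)).continuousAt
  eqn t := by
    subst hQ
    ext x
    have h := hasDerivAt_of_tendsto_smul ((BoundedContinuousFunction.evalCLM ℝ x).comp
      (SchwartzMap.toBoundedContinuousFunctionCLM ℝ ℝ ℂ)) (hd 0 t)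
    have h' : deriv (fun s => Q 0 s x) t = Q 1 t x := h.deriv
    have := hs t x
    rw [h'] at this
    exact dnls_deriv (fun y => ((Q 0 t).differentiable y).hasDerivAt)
      ((SchwartzMap.derivCLM ℂ ℂ (Q 0 t)).differentiable x).hasDerivAt this

/-- The Hilbert-Schmidt constants contribute κ · 1/(2κ) = 1/2, so c = 1 works for every κ at once.
-/
theorem line_conservation {q : ℝ → 𝓢(ℝ, ℂ)} (hq : IsSmoothSchwartzCurve q)
    (hs : SolvesDNLS fun t x => q t x)
    (hc : eLpNorm (q 0) 2 (volume : Measure ℝ) ≤ ENNReal.ofReal 1) (κ : ℝ) (hκ : 0 < κ) (t : ℝ) :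
    (∀ l : ℕ, 1 ≤ l → IsTraceClass (lineOp κ hκ (q t) ^ l)) ∧
      Summable (fun l : ℕ => detTerm κ (lineOp κ hκ (q t)) (l + 1)) ∧
      HasDerivAt (fun s => alpha κ (lineOp κ hκ (q s))) 0 t := by
  obtain ⟨Q, hQ, hd⟩ := hq
  set S := lineSolution hQ hd hs
  have hT : ∀ s, lineOp κ hκ (q s) = S.T κ s := fun s => by
    change _ = lineCalculus.R (-κ) * _ * (lineCalculus.R κ * _)
    rw [lineCalculus_R hκ.ne', lineCalculus_R (neg_ne_zero.2 hκ.ne')]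
    rfl
  have hu : ‖S.u 0‖ ≤ 1 := by
    have e : S.u 0 = ((q 0).memLp 2 volume).toLp := rfl
    rw [e]
    rw [Lp.norm_toLp]
    exact ENNReal.toReal_le_of_le_ofReal zero_le_one hc
  have hS : S.Small κ := by
    change κ * (√(1 / (2 * |-κ|)) * ‖S.u 0‖ * (√(1 / (2 * |κ|)) * ‖S.u 0‖)) ≤ 1 / 2
    rw [abs_neg, abs_of_pos hκ]
    calc _ = κ * (√(1 / (2 * κ)) * √(1 / (2 * κ))) * ‖S.u 0‖ ^ 2 := by ring
      _ = 1 / 2 * ‖S.u 0‖ ^ 2 := by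
        rw [Real.mul_self_sqrt (by positivity)]
        field_simp
      _ ≤ 1 / 2 * 1 := by
        gcongr
        exact pow_le_one₀ (norm_nonneg _) hu
      _ = 1 / 2 := mul_one _
  simp only [hT]
  exact ⟨fun l hl => S.isTraceClass_pow hκ.ne' t l hl, S.summable_detTerm hκ hS t,
    S.hasDerivAt_alpha hκ hS t⟩

end DNLS

end

noncomputable section

namespace DNLS

/-! ### Resolvents on the circle -/

/-- The normalized measure of the circle. -/
abbrev torusMeasure : Measure Torus := AddCircle.haarAddCircle

theorem memLp_torus (f : Torus →ᵇ ℂ) : MemLp f 2 torusMeasure :=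
  MemLp.of_bound f.continuous.aestronglyMeasurable ‖f‖ (Eventually.of_forall f.norm_coe_le_norm)

/-- `f'` is the derivative of `f`. -/
def TorusDer (f f' : Torus →ᵇ ℂ) : Prop :=
  ∀ x : ℝ, HasDerivAt (fun y : ℝ => f (y : Torus)) (f' (x : Torus)) x

theorem TorusDer.mul {f f' g g' : Torus →ᵇ ℂ} (hf : TorusDer f f') (hg : TorusDer g g') :
    TorusDer (f * g) (f' * g + f * g') := fun x => (hf x).mul (hg x)

/-- The exponential `e^{inx}` as a bounded continuous function. -/
def torusExp (n : ℤ) : Torus →ᵇ ℂ := BoundedContinuousFunction.mkOfCompact (fourier n)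

theorem torusDer_exp (n : ℤ) : TorusDer (torusExp n) ((n * Complex.I : ℂ) • torusExp n) := by
  intro x
  have h := hasDerivAt_fourier (2 * π) n x
  convert! h using 1
  change (n * Complex.I : ℂ) * fourier n (x : Torus) = _
  have : ((2 * π : ℝ) : ℂ) ≠ 0 := by exact_mod_cast Real.two_pi_pos.ne'
  push_cast at this ⊢
  field_simp

theorem TorusDer.integral_eq_zero {f f' : Torus →ᵇ ℂ} (hf : TorusDer f f') :
    ∫ x, f' x ∂torusMeasure = 0 := by
  -- The mean is the zeroth Fourier coefficient, an integral over one period.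
  have h := fourierCoeff_eq_intervalIntegral (T := 2 * π) f' 0 0
  simp only [fourierCoeff, neg_zero, fourier_zero, one_smul, zero_add] at h
  rw [h, intervalIntegral.integral_eq_sub_of_hasDerivAt (fun x _ => hf x)
    ((f'.continuous.comp (AddCircle.continuous_mk' _)).intervalIntegrable _ _)]
  have : ((2 * π : ℝ) : Torus) = ((0 : ℝ) : Torus) := AddCircle.coe_period _
  rw [this, sub_self, smul_zero]

theorem TorusDer.fourierCoeff_eq {f f' : Torus →ᵇ ℂ} (hf : TorusDer f f') (n : ℤ) :
    fourierCoeff f' n = n * Complex.I * fourierCoeff f n := by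
  have h := ((torusDer_exp (-n)).mul hf).integral_eq_zero
  have i1 : Integrable (fun x => torusExp (-n) x * f x) torusMeasure :=
    (memLp_torus (torusExp (-n) * f)).integrable one_le_two
  have i2 : Integrable (fun x => torusExp (-n) x * f' x) torusMeasure :=
    (memLp_torus (torusExp (-n) * f')).integrable one_le_two
  have e : ∀ x, (((-n : ℤ) * Complex.I : ℂ) • torusExp (-n) * f + torusExp (-n) * f' : Torus →ᵇ ℂ) x
      = -(n * Complex.I) * (torusExp (-n) x * f x) + torusExp (-n) x * f' x := fun x => by
    simp
  simp_rw [e] at h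
  rw [integral_add (i1.const_mul _) i2, integral_const_mul] at h
  change ∫ x, torusExp (-n) x * f' x ∂torusMeasure =
    n * Complex.I * ∫ x, torusExp (-n) x * f x ∂torusMeasure
  linear_combination h

theorem repr_torusResolvent (a : ℝ) (ha : a ≠ 0) (u : L2Torus) :
    (fourierBasis (T := 2 * π)).repr (torusResolvent a ha u) =
      diagOp a ha ((fourierBasis (T := 2 * π)).repr u) :=
  (fourierBasis (T := 2 * π)).repr.apply_symm_apply _

theorem fourierCoeff_torusResolvent (a : ℝ) (ha : a ≠ 0) (u : L2Torus) (n : ℤ) :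
    fourierCoeff (torusResolvent a ha u) n =
      ((a : ℂ) + ((n : ℝ) : ℂ) * Complex.I)⁻¹ * fourierCoeff u n := by
  rw [← fourierBasis_repr, ← fourierBasis_repr, repr_torusResolvent]
  rfl

theorem L2Torus_ext {u v : L2Torus} (h : ∀ n, fourierCoeff u n = fourierCoeff v n) : u = v := by
  apply (fourierBasis (T := 2 * π)).repr.injective
  ext n
  rw [fourierBasis_repr, fourierBasis_repr, h]

theorem fourierCoeff_add_L2 (u v : L2Torus) (n : ℤ) :
    fourierCoeff (u + v : L2Torus) n = fourierCoeff u n + fourierCoeff v n := by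
  simp only [← fourierBasis_repr, map_add]
  rfl

theorem fourierCoeff_smul_L2 (c : ℂ) (u : L2Torus) (n : ℤ) :
    fourierCoeff (c • u : L2Torus) n = c * fourierCoeff u n := by
  simp only [← fourierBasis_repr, map_smul]
  rfl

theorem norm_torusResolvent_le (a : ℝ) (ha : a ≠ 0) : ‖torusResolvent a ha‖ ≤ |a|⁻¹ := by
  refine ContinuousLinearMap.opNorm_le_bound _ (by positivity) fun u => ?_
  rw [← (fourierBasis (T := 2 * π)).repr.norm_map, repr_torusResolvent,
    ← (fourierBasis (T := 2 * π)).repr.norm_map u]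
  exact norm_diagFun_le a ha _

theorem torusResolvent_resolvent {a b : ℝ} (ha : a ≠ 0) (hb : b ≠ 0) :
    torusResolvent b hb = torusResolvent a ha +
      ((a - b : ℝ) : ℂ) • (torusResolvent a ha * torusResolvent b hb) := by
  ext1 u
  apply L2Torus_ext
  intro n
  rw [add_apply, smul_apply, mul_apply_eq_comp, fourierCoeff_add_L2, fourierCoeff_smul_L2]
  simp only [fourierCoeff_torusResolvent]
  have h1 := symbol_ne_zero a n ha
  have h2 := symbol_ne_zero b n hb
  field_simp
  push_cast
  ring

theorem torusResolvent_apply_of_der {a : ℝ} (ha : a ≠ 0) {g g' : Torus →ᵇ ℂ} (h : TorusDer g g') :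
    torusResolvent a ha ((memLp_torus g').toLp + (a : ℂ) • (memLp_torus g).toLp) =
      (memLp_torus g).toLp := by
  apply L2Torus_ext
  intro n
  rw [fourierCoeff_torusResolvent, fourierCoeff_add_L2, fourierCoeff_smul_L2,
    fourierCoeff_congr_ae (memLp_torus g').coeFn_toLp,
    fourierCoeff_congr_ae (memLp_torus g).coeFn_toLp, h.fourierCoeff_eq,
    inv_mul_eq_iff_eq_mul₀ (symbol_ne_zero a n ha)]
  push_cast
  ring

theorem fourierBasis_eq_toLp (n : ℤ) :
    fourierBasis (T := 2 * π) n = (memLp_torus (torusExp n)).toLp := by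
  rw [coe_fourierBasis]
  apply Lp.ext
  filter_upwards [coeFn_fourierLp 2 n, (memLp_torus (torusExp n)).coeFn_toLp] with x h1 h2
  rw [h1, h2]
  rfl

theorem toLp_add_bcf (f g : Torus →ᵇ ℂ) :
    (memLp_torus (f + g)).toLp = (memLp_torus f).toLp + (memLp_torus g).toLp := rfl

theorem toLp_smul_bcf (c : ℂ) (f : Torus →ᵇ ℂ) :
    (memLp_torus (c • f)).toLp = c • (memLp_torus f).toLp := rfl

theorem mulOp_toLp_bcf (f g : Torus →ᵇ ℂ) :
    mulOp torusMeasure f (memLp_torus g).toLp = (memLp_torus (f * g)).toLp :=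
  mulOp_toLp f (memLp_torus g) (memLp_torus (f * g))

/-- Checked on the exponentials, which are eigenvectors of R b; there it is the product rule for f
e^{inx}. -/
theorem torusResolvent_mul_mulOp_mul {f f' : Torus →ᵇ ℂ} (hf : TorusDer f f') {a b : ℝ}
    (ha : a ≠ 0) (hb : b ≠ 0) :
    torusResolvent a ha * mulOp torusMeasure f' * torusResolvent b hb =
      mulOp torusMeasure f * torusResolvent b hb - torusResolvent a ha * mulOp torusMeasure f +
        ((b - a : ℝ) : ℂ) •
          (torusResolvent a ha * mulOp torusMeasure f * torusResolvent b hb) := by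
  refine ContinuousLinearMap.ext_on (s := Set.range (fourierBasis (T := 2 * π)))
    (Submodule.dense_iff_topologicalClosure_eq_top.2 (fourierBasis (T := 2 * π)).dense_span) ?_
  rintro _ ⟨n, rfl⟩
  have hu := torusDer_exp n
  set E := torusExp n
  have h0 := symbol_ne_zero b n hb
  have hR := torusResolvent_apply_of_der hb hu
  have key := torusResolvent_apply_of_der ha (hf.mul hu)
  rw [toLp_add_bcf, mul_smul_comm, toLp_smul_bcf, ← mulOp_toLp_bcf, ← mulOp_toLp_bcf] at key
  rw [toLp_smul_bcf] at hR
  rw [fourierBasis_eq_toLp]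
  set e : L2Torus := (memLp_torus E).toLp
  have hR' : torusResolvent b hb e = ((b : ℂ) + ((n : ℝ) : ℂ) * Complex.I)⁻¹ • e := by
    rw [eq_inv_smul_iff₀ h0]
    conv_rhs => rw [← hR]
    rw [← map_smul]
    congr 1
    push_cast
    module
  simp only [add_apply, sub_apply, smul_apply, mul_apply_eq_comp, hR', map_smul]
  apply smul_right_injective _ h0
  simp only [smul_add, smul_sub, map_add, map_smul] at key ⊢
  simp only [smul_comm _ (((b : ℂ) + ((n : ℝ) : ℂ) * Complex.I)⁻¹), inv_smul_smul₀ h0]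
  refine sub_eq_zero.1 ((?_ : _ = _ - _).trans (sub_eq_zero.2 key))
  push_cast
  module

theorem tsum_inv_sq_add_sq_le {a : ℝ} (ha : a ≠ 0) :
    ∑' n : ℤ, ENNReal.ofReal ((a ^ 2 + (n : ℝ) ^ 2)⁻¹) ≤
      ENNReal.ofReal ((a ^ 2)⁻¹ + 4 / |a|) := by
  have hb : 0 < |a| := abs_pos.2 ha
  rw [← sq_abs a]
  set b := |a|
  -- The right side is 2/((b + n)(b + n + 1)), and (b + n + 1)² ≤ 2(b² + (n + 1)²). Each half of the
  -- sum thus telescopes to at most 2/b.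
  have hterm : ∀ n : ℕ, (b ^ 2 + ((n : ℝ) + 1) ^ 2)⁻¹ ≤ 2 / (b + n) - 2 / (b + (n + 1 : ℕ)) := by
    intro n
    push_cast
    rw [div_sub_div _ _ (by positivity) (by positivity), inv_le_iff_one_le_mul₀ (by positivity),
      mul_comm, mul_div_assoc', le_div_iff₀ (by positivity)]
    nlinarith [sq_nonneg (b - (n + 1)), (Nat.cast_nonneg n : (0 : ℝ) ≤ n)]
  have hpart : ∑' n : ℕ, ENNReal.ofReal ((b ^ 2 + ((n : ℝ) + 1) ^ 2)⁻¹) ≤ ENNReal.ofReal (2 / b) := by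
    refine ENNReal.tsum_le_of_sum_range_le fun N => ?_
    rw [← ENNReal.ofReal_sum_of_nonneg fun _ _ => by positivity]
    refine ENNReal.ofReal_le_ofReal ((Finset.sum_le_sum fun n _ => hterm n).trans ?_)
    rw [Finset.sum_range_sub' (fun n : ℕ => 2 / (b + n))]
    simp only [Nat.cast_zero, add_zero, sub_le_self_iff]
    positivity
  rw [tsum_of_nat_of_neg_add_one ENNReal.summable ENNReal.summable, tsum_eq_zero_add'
    ENNReal.summable]
  have e1 : ∀ n : ℕ, ((-((n : ℤ) + 1) : ℤ) : ℝ) ^ 2 = ((n : ℝ) + 1) ^ 2 := fun n => by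
    push_cast; ring
  have e2 : ∀ n : ℕ, (((n + 1 : ℕ) : ℤ) : ℝ) = (n : ℝ) + 1 := fun n => by push_cast; ring
  simp_rw [e1, e2]
  refine (add_le_add (add_le_add le_rfl hpart) hpart).trans ?_
  rw [← ENNReal.ofReal_add (by positivity) (by positivity),
    ← ENNReal.ofReal_add (by positivity) (by positivity)]
  refine ENNReal.ofReal_le_ofReal (le_of_eq ?_)
  simp
  ring

theorem torusResolvent_hs {a : ℝ} (ha : a ≠ 0) {f : Torus →ᵇ ℂ} (hf : MemLp f 2 torusMeasure) :
    torusResolvent a ha * mulOp torusMeasure f ∈ HS L2Torus ∧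
      hsNorm (torusResolvent a ha * mulOp torusMeasure f) ≤
        √((a ^ 2)⁻¹ + 4 / |a|) * ‖hf.toLp‖ := by
  have hinner : ∀ (u : L2Torus) (n : ℤ), inner ℂ ((memLp_torus (torusExp n * star f)).toLp) u =
      fourierCoeff (mulOp torusMeasure f u) n := by
    intro u n
    rw [L2.inner_def, fourierCoeff]
    refine integral_congr_ae ?_
    filter_upwards [(memLp_torus (torusExp n * star f)).coeFn_toLp, coeFn_mulOp torusMeasure f u]
      with x h1 h2
    rw [h1, h2, fourier_neg]
    change u x * (starRingEnd ℂ) (fourier n x * star (f x)) = _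
    simp
    ring
  refine mem_HS_of_lintegral (ν := Measure.count)
    (ρ := fun n : ℤ => ENNReal.ofReal (‖((a : ℂ) + ((n : ℝ) : ℂ) * Complex.I)⁻¹‖ ^ 2))
    (v := fun n => (memLp_torus (torusExp n * star f)).toLp)
    (Real.sqrt_nonneg _) (norm_nonneg _) (fun n => ?_) (measurable_from_top).aemeasurable
    (fun u => (measurable_from_top).aemeasurable) (fun u => ?_) ?_
  · refine Lp.norm_le_norm_of_ae_le ?_
    filter_upwards [(memLp_torus (torusExp n * star f)).coeFn_toLp, hf.coeFn_toLp] with x h1 h2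
    rw [h1, h2]
    change ‖fourier n x * star (f x)‖ ≤ _
    rw [norm_mul, norm_star, fourier_apply, Circle.norm_coe, one_mul]
  · rw [mul_apply_eq_comp, lintegral_count, ← (fourierBasis (T := 2 * π)).repr.norm_map]
    have h := lp.hasSum_norm (by norm_num) ((fourierBasis (T := 2 * π)).repr
      (torusResolvent a ha (mulOp torusMeasure f u)))
    simp only [ENNReal.toReal_ofNat, Real.rpow_two] at h
    rw [← h.tsum_eq, ENNReal.ofReal_tsum_of_nonneg (fun _ => by positivity) h.summable]
    refine (tsum_congr fun n => ?_).le
    rw [fourierBasis_repr, fourierCoeff_torusResolvent, hinner, norm_mul, mul_pow,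
      ENNReal.ofReal_mul (by positivity)]
  · rw [lintegral_count, Real.sq_sqrt (by positivity)]
    refine (tsum_congr fun n => ?_).trans_le (tsum_inv_sq_add_sq_le ha)
    rw [norm_inv, inv_pow, Complex.sq_norm, Complex.normSq_add_mul_I]

/-- Multiplication, differentiation and the resolvents on the circle. -/
def torusCalculus : ResolventCalculus torusMeasure where
  R a := if h : a ≠ 0 then torusResolvent a h else 0
  Der := TorusDer
  hsConst a := √((a ^ 2)⁻¹ + 4 / |a|)
  w := 1
  w' := 0
  der_mul hf hg := hf.mul hg
  der_add hf hg x := (hf x).add (hg x)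
  der_star hf x := (hf x).star
  integral_der hf _ _ := hf.integral_eq_zero
  der_comm hf a b ha hb := by
    simp only [dif_pos ha, dif_pos hb]
    exact torusResolvent_mul_mulOp_mul hf ha hb
  resolvent ha hb := by
    simp only [dif_pos ha, dif_pos hb]
    exact torusResolvent_resolvent ha hb
  norm_le ha := by
    simp only [dif_pos ha]
    exact norm_torusResolvent_le _ ha
  hs ha f hf := by
    simp only [dif_pos ha]
    exact torusResolvent_hs ha hf
  hsConst_tendsto := by
    have h1 : Tendsto (fun a : ℝ => (a ^ 2)⁻¹) atTop (𝓝 0) :=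
      tendsto_inv_atTop_zero.comp (tendsto_pow_atTop two_ne_zero)
    have h2 : Tendsto (fun a : ℝ => 4 / |a|) atTop (𝓝 0) :=
      tendsto_const_nhds.div_atTop tendsto_abs_atTop_atTop
    have h := h1.add h2
    rw [add_zero] at h
    rw [← Real.sqrt_zero]
    exact (Real.continuous_sqrt.tendsto 0).comp h
  der_w x := hasDerivAt_const x 1
  memLp_w := memLp_torus 1
  memLp_w' := memLp_torus 0

theorem torusCalculus_divisible (f : Torus →ᵇ ℂ) : torusCalculus.Divisible f :=
  ⟨f, memLp_torus f, (mul_one f).symm⟩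

theorem torusCalculus_R {a : ℝ} (ha : a ≠ 0) : torusCalculus.R a = torusResolvent a ha :=
  dif_pos ha

end DNLS

end

noncomputable section

namespace DNLS

/-! ### Smooth functions of time and of a point of the circle -/

/-- Pointwise derivatives become a derivative in sup norm by writing the increment as the integral
of a continuous curve in C(Y). -/
theorem hasDerivAt_curry {Y : Type*} [TopologicalSpace Y] [CompactSpace Y] {G G' : C(ℝ × Y, ℂ)}
    (h : ∀ t y, HasDerivAt (fun s => G (s, y)) (G' (t, y)) t) (t : ℝ) :
    HasDerivAt (fun s => G.curry s) (G'.curry t) t := by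
  have hc : Continuous fun s => G'.curry s := G'.curry.continuous
  have e : (fun s => G.curry s) = fun s => G.curry t + ∫ r in t..s, G'.curry r := by
    ext s y
    have h1 := (ContinuousMap.evalCLM ℂ y : C(Y, ℂ) →L[ℂ] ℂ).intervalIntegral_comp_comm
      (hc.intervalIntegrable (μ := volume) t s)
    have h2 := intervalIntegral.integral_eq_sub_of_hasDerivAt (a := t) (b := s)
      (fun r _ => h r y)
      ((G'.continuous.comp (by fun_prop : Continuous fun r : ℝ => (r, y))).intervalIntegrable _ _)
    change G (s, y) = G (t, y) + ContinuousMap.evalCLM ℂ y (∫ r in t..s, G'.curry r)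
    rw [← h1]
    exact (add_eq_of_eq_sub' h2).symm
  rw [e]
  exact (intervalIntegral.integral_hasDerivAt_right (hc.intervalIntegrable _ _)
    (hc.stronglyMeasurableAtFilter _ _) hc.continuousAt).const_add _

/-- Smooth functions on `ℝ × ℝ` that are `2π`-periodic in the second variable. -/
structure SmoothPeriodic (F : ℝ × ℝ → ℂ) : Prop where
  contDiff : ContDiff ℝ ∞ F
  periodic : ∀ t, Function.Periodic (fun x => F (t, x)) (2 * π)

namespace SmoothPeriodic

variable {F : ℝ × ℝ → ℂ}

theorem fderiv (hF : SmoothPeriodic F) (v : ℝ × ℝ) : SmoothPeriodic fun p => _root_.fderiv ℝ F p v where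
  contDiff := (hF.contDiff.fderiv_right (m := ∞) le_rfl).clm_apply contDiff_const
  periodic t x := by
    have e : (fun p : ℝ × ℝ => F (p + (0, 2 * π))) = F := by
      ext ⟨s, y⟩
      simpa using hF.periodic s y
    have h := fderiv_comp_add_right (𝕜 := ℝ) (f := F) (x := (t, x)) (0, 2 * π)
    rw [e] at h
    simp [h]

theorem hasFDerivAt (hF : SmoothPeriodic F) (p : ℝ × ℝ) : HasFDerivAt F (_root_.fderiv ℝ F p) p :=
  (hF.contDiff.differentiable (by simp) p).hasFDerivAt

theorem hasDerivAt_fst (hF : SmoothPeriodic F) (t x : ℝ) :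
    HasDerivAt (fun s => F (s, x)) (_root_.fderiv ℝ F (t, x) (1, 0)) t :=
  (hF.hasFDerivAt (t, x)).comp_hasDerivAt t ((hasDerivAt_id t).prodMk (hasDerivAt_const t x))

theorem hasDerivAt_snd (hF : SmoothPeriodic F) (t x : ℝ) :
    HasDerivAt (fun y => F (t, y)) (_root_.fderiv ℝ F (t, x) (0, 1)) x :=
  (hF.hasFDerivAt (t, x)).comp_hasDerivAt x ((hasDerivAt_const x t).prodMk (hasDerivAt_id x))

/-- The induced function on `ℝ × 𝕋`. -/
def lift (hF : SmoothPeriodic F) : C(ℝ × Torus, ℂ) where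
  toFun p := (hF.periodic p.1).lift p.2
  continuous_toFun := by
    -- The product map ℝ × ℝ → ℝ × 𝕋 is still a quotient map because it is open, so continuity
    -- descends.
    have h : IsOpenQuotientMap (Prod.map id ((↑) : ℝ → Torus) : ℝ × ℝ → ℝ × Torus) :=
      IsOpenQuotientMap.id.prodMap QuotientAddGroup.isOpenQuotientMap_mk
    rw [h.isQuotientMap.continuous_iff]
    exact hF.contDiff.continuous

/-- The function on the circle at time `t`. -/
def slice (hF : SmoothPeriodic F) (t : ℝ) : Torus →ᵇ ℂ :=
  BoundedContinuousFunction.mkOfCompact (hF.lift.curry t)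

theorem reg_slice (hF : SmoothPeriodic F) (t : ℝ) :
    torusCalculus.Reg (hF.slice t) ((hF.fderiv (0, 1)).slice t) where
  der x := hF.hasDerivAt_snd t x
  memLp := memLp_torus _
  memLp' := memLp_torus _

theorem hasDerivAt_toLp (hF : SmoothPeriodic F) (t : ℝ) : HasDerivAt (fun s => (memLp_torus (hF.slice s)).toLp)
    (memLp_torus ((hF.fderiv (1, 0)).slice t)).toLp t := by
  have h := hasDerivAt_curry (G := hF.lift) (G' := (hF.fderiv (1, 0)).lift) (fun s y => by
    induction y using QuotientAddGroup.induction_on with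
    | H x => exact hF.hasDerivAt_fst s x) t
  exact (ContinuousMap.toLp (E := ℂ) 2 torusMeasure ℝ).hasFDerivAt.comp_hasDerivAt t h

end SmoothPeriodic

theorem Torus_bcf_ext {f g : Torus →ᵇ ℂ} (h : ∀ x : ℝ, f (x : Torus) = g (x : Torus)) : f = g := by
  ext y
  induction y using QuotientAddGroup.induction_on with
  | H x => exact h x

/-- The solution on the circle given by a smooth function. -/
def torusSolution {F : ℝ × ℝ → ℂ} (hF : SmoothPeriodic F) (hs : SolvesDNLS fun t x => F (t, x)) :
    torusCalculus.Solution where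
  q := hF.slice
  q₁ := (hF.fderiv (0, 1)).slice
  q₂ := ((hF.fderiv (0, 1)).fderiv (0, 1)).slice
  hq := hF.reg_slice
  hq₁ := (hF.fderiv (0, 1)).reg_slice
  div_q _ := torusCalculus_divisible _
  div_q₁ _ := torusCalculus_divisible _
  div_star_q₁ _ := torusCalculus_divisible _
  qt := (hF.fderiv (1, 0)).slice
  memLp_qt _ := memLp_torus _
  hasDerivAt := hF.hasDerivAt_toLp
  continuous_qt := continuous_iff_continuousAt.2 fun t =>
    ((hF.fderiv (1, 0)).hasDerivAt_toLp t).continuousAt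
  eqn t := Torus_bcf_ext fun x => by
    have h := hs t x
    rw [(hF.hasDerivAt_fst t x).deriv] at h
    exact dnls_deriv (hF.hasDerivAt_snd t) ((hF.fderiv (0, 1)).hasDerivAt_snd t x) h

/-- Smallness is assumed for the measure of mass 2π, but the operators act on L² of the normalized
one; as 2π ≥ 1 the bound passes over. -/
theorem torusMeasure_le_volume : torusMeasure ≤ (volume : Measure Torus) := by
  rw [AddCircle.volume_eq_smul_haarAddCircle]
  refine Measure.le_iff'.2 fun s => ?_
  rw [Measure.smul_apply, smul_eq_mul]
  refine le_mul_of_one_le_left zero_le ?_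
  rw [ENNReal.one_le_ofReal]
  nlinarith [Real.pi_gt_three]

/-- Here κ(κ⁻² + 4/κ) = κ⁻¹ + 4 ≤ κ₀⁻¹ + 4, and c is chosen so that (κ₀⁻¹ + 4) c² = 1/2. -/
theorem torus_conservation {κ₀ : ℝ} (hκ₀ : 0 < κ₀) {q : ℝ → C(Torus, ℂ)}
    (hq : IsSmoothTorusCurve q) (hs : SolvesDNLS fun t x => q t (x : Torus))
    (hc : eLpNorm (q 0) 2 (volume : Measure Torus) ≤ ENNReal.ofReal √(1 / (2 * (κ₀⁻¹ + 4))))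
    (κ : ℝ) (hκ : 0 < κ) (hle : κ₀ ≤ κ) (t : ℝ) :
    (∀ l : ℕ, 1 ≤ l → IsTraceClass (torusOp κ hκ (q t) ^ l)) ∧
      Summable (fun l : ℕ => detTerm κ (torusOp κ hκ (q t)) (l + 1)) ∧
      HasDerivAt (fun s => alpha κ (torusOp κ hκ (q s))) 0 t := by
  have hF : SmoothPeriodic fun p : ℝ × ℝ => q p.1 (p.2 : Torus) :=
    ⟨hq, fun t x => congrArg (q t) (AddCircle.coe_add_period (2 * π) x)⟩
  set S := torusSolution hF hs
  have hslice : ∀ s, BoundedContinuousFunction.mkOfCompact (q s) = hF.slice s := fun s =>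
    Torus_bcf_ext fun x => rfl
  have hT : ∀ s, torusOp κ hκ (q s) = S.T κ s := fun s => by
    change _ = torusCalculus.R (-κ) * mulOp torusMeasure (hF.slice s) *
      (torusCalculus.R κ * mulOp torusMeasure (star (hF.slice s)))
    rw [torusCalculus_R hκ.ne', torusCalculus_R (neg_ne_zero.2 hκ.ne'), ← hslice]
    rfl
  have hu : ‖S.u 0‖ ≤ √(1 / (2 * (κ₀⁻¹ + 4))) := by
    have e : S.u 0 = (memLp_torus (hF.slice 0)).toLp := rfl
    rw [e, Lp.norm_toLp, ← hslice]
    exact ENNReal.toReal_le_of_le_ofReal (Real.sqrt_nonneg _)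
      ((eLpNorm_mono_measure _ torusMeasure_le_volume).trans hc)
  have hS : S.Small κ := by
    change κ * (√(((-κ) ^ 2)⁻¹ + 4 / |-κ|) * ‖S.u 0‖ * (√((κ ^ 2)⁻¹ + 4 / |κ|) * ‖S.u 0‖)) ≤ 1 / 2
    rw [neg_sq, abs_neg, abs_of_pos hκ]
    calc _ = κ * (√((κ ^ 2)⁻¹ + 4 / κ) * √((κ ^ 2)⁻¹ + 4 / κ)) * ‖S.u 0‖ ^ 2 := by ring
      _ = (κ⁻¹ + 4) * ‖S.u 0‖ ^ 2 := by
        rw [Real.mul_self_sqrt (by positivity)]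
        field_simp
      _ ≤ (κ₀⁻¹ + 4) * (1 / (2 * (κ₀⁻¹ + 4))) := by
        have h := pow_le_pow_left₀ (norm_nonneg _) hu 2
        rw [Real.sq_sqrt (by positivity)] at h
        gcongr
      _ = 1 / 2 := by field_simp
  simp only [hT]
  exact ⟨fun l hl => S.isTraceClass_pow hκ.ne' t l hl, S.summable_detTerm hκ hS t,
    S.hasDerivAt_alpha hκ hS t⟩

end DNLS

end

/-! ### Both geometries, with explicit smallness constants -/

theorem proposition2 :
    (∃ c : ℝ, 0 < c ∧
      ∀ q : ℝ → 𝓢(ℝ, ℂ), DNLS.IsSmoothSchwartzCurve q →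
        DNLS.SolvesDNLS (fun t x => q t x) →
        eLpNorm (q 0) 2 (volume : Measure ℝ) ≤ ENNReal.ofReal c →
        ∀ (κ : ℝ) (hκ : 0 < κ) (t : ℝ),
          (∀ l : ℕ, 1 ≤ l → DNLS.IsTraceClass (DNLS.lineOp κ hκ (q t) ^ l)) ∧
          Summable (fun l : ℕ => DNLS.detTerm κ (DNLS.lineOp κ hκ (q t)) (l + 1)) ∧
          HasDerivAt (fun s => DNLS.alpha κ (DNLS.lineOp κ hκ (q s))) 0 t) ∧
    (∀ κ₀ : ℝ, 0 < κ₀ → ∃ c : ℝ, 0 < c ∧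
      ∀ q : ℝ → C(DNLS.Torus, ℂ), DNLS.IsSmoothTorusCurve q →
        DNLS.SolvesDNLS (fun t x => q t (x : DNLS.Torus)) →
        eLpNorm (q 0) 2 (volume : Measure DNLS.Torus) ≤ ENNReal.ofReal c →
        ∀ (κ : ℝ) (hκ : 0 < κ), κ₀ ≤ κ → ∀ t : ℝ,
          (∀ l : ℕ, 1 ≤ l → DNLS.IsTraceClass (DNLS.torusOp κ hκ (q t) ^ l)) ∧
          Summable (fun l : ℕ => DNLS.detTerm κ (DNLS.torusOp κ hκ (q t)) (l + 1)) ∧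
          HasDerivAt (fun s => DNLS.alpha κ (DNLS.torusOp κ hκ (q s))) 0 t) :=
  ⟨⟨1, one_pos, fun _ hq hs hc κ hκ t => DNLS.line_conservation hq hs hc κ hκ t⟩,
    fun κ₀ hκ₀ => ⟨√(1 / (2 * (κ₀⁻¹ + 4))), by positivity, fun _ hq hs hc κ hκ hle t =>
      DNLS.torus_conservation hκ₀ hq hs hc κ hκ hle t⟩⟩
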